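/- **Theorem (Low-Rank Approximation: Frobenius Error).** Let $\mathbb{F}=\mathbb{R}$ or $\mathbb{F}=\mathbb{C}$, and put $\alpha:=1$ if $\mathbb{F}=\mathbb{R}$ and $\alpha:=0$ if $\mathbb{F}=\mathbb{C}$. Let $A\in\mathbb{F}^{m\times n}$, and let $k,\ell$ be natural numbers with $\alpha<k\le m$ and $\ell>k+\alpha$. A random matrix over $\mathbb{R}$ is *standard normal* if its entries are independent $N(0,1)$ variables; a random matrix over $\mathbb{C}$ is *standard normal* if it equals $G_1+\mathrm{i}\,G_2$ with $G_1,G_2$ independent real standard normal matrices. Let $\Omega\in\mathbb{F}^{n\times k}$ and $\Psi\in\mathbb{F}^{\ell\times m}$ be independent standard normal matrices. Form $Y:=A\Omega$, let $Q=Q(Y)\in\mathbb{F}^{m\times k}$ be the factor with orthonormal columns in an orthogonal–triangular factorization $Y=QR$ ($R\in\mathbb{F}^{k\times k}$ upper triangular), where $Y\mapsto Q(Y)$ is any fixed measurable rule producing such a factor for every $Y\in\mathbb{F}^{m\times k}$, and set $$\hat A:=Q\,(\Psi Q)^{\dagger}\,(\Psi A),$$ where ${}^\dagger$ is the Moore–Penrose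 pseudoinverse. Then $\|A-\hat A\|_F^2$ is integrable and $$ \mathbb{E}\,\|A-\hat A\|_F^2\;\le\;(1+f(k,\ell))\cdot\min_{\varrho<k-\alpha}(1+f(\varrho,k))\,\tau_{\varrho+1}^2(A) \;=\;\frac{\ell-\alpha}{\ell-k-\alpha}\cdot\min_{\varrho<k-\alpha}\frac{k-\alpha}{k-\varrho-\alpha}\,\tau_{\varrho+1}^2(A). $$ Here $\varrho$ ranges over the natural numbers ($0$ included), $f(s,t):=\dfrac{s}{t-s-\alpha}$, and $\tau_j^2(A):=\min_{\operatorname{rank}(B)<j}\|A-B\|_F^2$ (minimum over $B\in\mathbb{F}^{m\times n}$) for $j\ge1$. -/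

import Mathlib

open MeasureTheory ProbabilityTheory
open scoped Matrix

namespace SketchLowRank

noncomputable section

/-! ## Matrices: Frobenius norm, tail energy, pseudoinverse, QR factorization -/

section MatrixNotions

variable {𝕜 : Type*} [RCLike 𝕜] {m n : ℕ}

/-- The squared Frobenius norm of a matrix. -/
def frobSq (M : Matrix (Fin m) (Fin n) 𝕜) : ℝ := ∑ i, ∑ j, ‖M i j‖ ^ 2

/-- The squared tail energy `τ_j²(A)`: the smallest squared Frobenius error over all matrices `B`
of rank strictly less than `j`. It is meant for `j ≥ 1`, where `B = 0` is a competitor. -/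
def tailEnergySq (j : ℕ) (A : Matrix (Fin m) (Fin n) 𝕜) : ℝ :=
  ⨅ B : {B : Matrix (Fin m) (Fin n) 𝕜 // B.rank < j}, frobSq (A - B.1)

/-- The four Penrose equations, saying that `B` is the Moore-Penrose pseudoinverse of `A`. -/
structure IsMoorePenrose (A : Matrix (Fin m) (Fin n) 𝕜) (B : Matrix (Fin n) (Fin m) 𝕜) :
    Prop where
  mul_mul_left : A * B * A = A
  mul_mul_right : B * A * B = B
  isHermitian_left : (A * B)ᴴ = A * B
  isHermitian_right : (B * A)ᴴ = B * A

theorem IsMoorePenrose.unique {A : Matrix (Fin m) (Fin n) 𝕜} {B C : Matrix (Fin n) (Fin m) 𝕜}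
    (hB : IsMoorePenrose A B) (hC : IsMoorePenrose A C) : B = C := by
  have h1 : A * B = A * C := by
    calc A * B = (A * C * A) * B := by rw [hC.mul_mul_left]
      _ = (A * C)ᴴ * (A * B)ᴴ := by
          rw [hC.isHermitian_left, hB.isHermitian_left]; simp only [Matrix.mul_assoc]
      _ = ((A * B * A) * C)ᴴ := by
          rw [← Matrix.conjTranspose_mul]; simp only [Matrix.mul_assoc]
      _ = A * C := by rw [hB.mul_mul_left, hC.isHermitian_left]
  have h2 : B * A = C * A := by
    calc B * A = B * (A * C * A) := by rw [hC.mul_mul_left]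
      _ = (B * A)ᴴ * (C * A)ᴴ := by
          rw [hC.isHermitian_right, hB.isHermitian_right]; simp only [Matrix.mul_assoc]
      _ = (C * (A * B * A))ᴴ := by
          rw [← Matrix.conjTranspose_mul]; simp only [Matrix.mul_assoc]
      _ = C * A := by rw [hB.mul_mul_left, hC.isHermitian_right]
  calc B = B * A * B := hB.mul_mul_right.symm
    _ = C * (A * B) := by rw [h2, Matrix.mul_assoc]
    _ = C := by rw [h1, ← Matrix.mul_assoc, hC.mul_mul_right]

open scoped ComplexOrder in
theorem exists_isMoorePenrose (A : Matrix (Fin m) (Fin n) 𝕜) :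
    ∃ B : Matrix (Fin n) (Fin m) 𝕜, IsMoorePenrose A B := by
  have hH : (Aᴴ * A).IsHermitian := Matrix.isHermitian_conjTranspose_mul_self A
  obtain ⟨K, hK1, hK2, hK3, hK4⟩ : ∃ K : Matrix (Fin n) (Fin n) 𝕜,
      (Aᴴ * A) * K * (Aᴴ * A) = Aᴴ * A ∧ K * (Aᴴ * A) * K = K ∧ Kᴴ = K ∧
      (Aᴴ * A) * K = K * (Aᴴ * A) := by
    have hs := hH.spectral_theorem
    rw [Unitary.conjStarAlgAut_apply] at hs
    set U : Matrix (Fin n) (Fin n) 𝕜 := (hH.eigenvectorUnitary : Matrix (Fin n) (Fin n) 𝕜)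
    set d : Fin n → 𝕜 := RCLike.ofReal ∘ hH.eigenvalues with hd
    have hUU : star U * U = 1 := Unitary.coe_star_mul_self hH.eigenvectorUnitary
    have key : ∀ D E : Matrix (Fin n) (Fin n) 𝕜,
        (U * D * star U) * (U * E * star U) = U * (D * E) * star U := by
      intro D E
      calc (U * D * star U) * (U * E * star U) = U * D * (star U * U) * E * star U := by
            simp only [Matrix.mul_assoc]
        _ = _ := by rw [hUU]; simp only [Matrix.mul_assoc, Matrix.one_mul]
    refine ⟨U * Matrix.diagonal (fun i => (d i)⁻¹) * star U, ?_, ?_, ?_, ?_⟩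
    · rw [hs, key, key, Matrix.diagonal_mul_diagonal, Matrix.diagonal_mul_diagonal]
      congr 3
      ext i
      by_cases h : d i = 0 <;> simp [h]
    · rw [hs, key, key, Matrix.diagonal_mul_diagonal, Matrix.diagonal_mul_diagonal]
      congr 3
      ext i
      by_cases h : d i = 0 <;> simp [h]
    · simp only [Matrix.star_eq_conjTranspose, Matrix.conjTranspose_mul,
        Matrix.conjTranspose_conjTranspose, Matrix.diagonal_conjTranspose, ← Matrix.mul_assoc]
      congr 3
      ext i
      simp [hd]
    · rw [hs, key, key, Matrix.diagonal_mul_diagonal, Matrix.diagonal_mul_diagonal]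
      simp only [mul_comm]
  have hA : A * (K * (Aᴴ * A)) = A := by
    have h0 : Aᴴ * A * (K * (Aᴴ * A) - 1) = 0 := by
      rw [Matrix.mul_sub, ← Matrix.mul_assoc, hK1, Matrix.mul_one, sub_self]
    have h1 := (Matrix.conjTranspose_mul_self_mul_eq_zero A _).1 h0
    rw [Matrix.mul_sub, Matrix.mul_one, sub_eq_zero] at h1
    exact h1
  refine ⟨K * Aᴴ, ?_, ?_, ?_, ?_⟩
  · simpa only [Matrix.mul_assoc] using hA
  · calc K * Aᴴ * A * (K * Aᴴ) = (K * (Aᴴ * A) * K) * Aᴴ := by simp only [Matrix.mul_assoc]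
      _ = K * Aᴴ := by rw [hK2]
  · simp only [Matrix.conjTranspose_mul, Matrix.conjTranspose_conjTranspose, hK3,
      Matrix.mul_assoc]
  · simp only [Matrix.conjTranspose_mul, Matrix.conjTranspose_conjTranspose, hK3]
    rw [← Matrix.mul_assoc, hK4, Matrix.mul_assoc]

/-- The Moore-Penrose pseudoinverse `A†`. -/
def pinv (A : Matrix (Fin m) (Fin n) 𝕜) : Matrix (Fin n) (Fin m) 𝕜 :=
  (exists_isMoorePenrose A).choose

theorem isMoorePenrose_pinv (A : Matrix (Fin m) (Fin n) 𝕜) : IsMoorePenrose A (pinv A) :=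
  (exists_isMoorePenrose A).choose_spec

/-- `Q` is an orthonormal factor in an orthogonal-triangular factorization `Y = Q R`:
it has the same shape as `Y`, its columns are orthonormal, and `R` is upper triangular. -/
def IsQRFactor (Y Q : Matrix (Fin m) (Fin n) 𝕜) : Prop :=
  Qᴴ * Q = 1 ∧ ∃ R : Matrix (Fin n) (Fin n) 𝕜, R.IsUpperTriangular ∧ Y = Q * R

/-- The approximation `Â = Q (Ψ Q)† (Ψ A)` assembled from the orthonormal factor `Q` and the
co-range sketch `Ψ A`. -/
def approx {ℓ k : ℕ} (A : Matrix (Fin m) (Fin n) 𝕜) (Ψ : Matrix (Fin ℓ) (Fin m) 𝕜)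
    (Q : Matrix (Fin m) (Fin k) 𝕜) : Matrix (Fin m) (Fin n) 𝕜 :=
  Q * (pinv (Ψ * Q) * (Ψ * A))

end MatrixNotions

/-! ## Standard normal matrices -/

section StandardNormal

/-- Matrices carry the product sigma-algebra of their entries. -/
instance instMeasurableSpaceMatrix {ι κ R : Type*} [MeasurableSpace R] :
    MeasurableSpace (Matrix ι κ R) :=
  inferInstanceAs (MeasurableSpace (ι → κ → R))

variable {S : Type*} [MeasurableSpace S] {p q : ℕ}

/-- Real standard normal matrix: the entries are independent, each with law `N(0,1)`. -/
structure IsRealStandardNormal (G : S → Matrix (Fin p) (Fin q) ℝ) (P : Measure S) : Prop where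
  indep : iIndepFun (fun (e : Fin p × Fin q) (s : S) => G s e.1 e.2) P
  law : ∀ e : Fin p × Fin q, HasLaw (fun s => G s e.1 e.2) (gaussianReal 0 1) P

/-- Standard normal matrix over `𝕜 = ℝ` or `𝕜 = ℂ`. The real part is a real standard normal
matrix; over `ℂ` (the case where the imaginary unit of `𝕜` is nonzero) the imaginary part is another
one, independent of the real part. So `G = G₁` over `ℝ` and `G = G₁ + i G₂` over `ℂ`. -/
structure IsStandardNormal {𝕜 : Type*} [RCLike 𝕜] (G : S → Matrix (Fin p) (Fin q) 𝕜)
    (P : Measure S) : Prop where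
  re : IsRealStandardNormal (fun s => (G s).map RCLike.re) P
  im : (RCLike.I : 𝕜) ≠ 0 → IsRealStandardNormal (fun s => (G s).map RCLike.im) P
  indep : (RCLike.I : 𝕜) ≠ 0 →
    IndepFun (fun s => (G s).map (RCLike.re : 𝕜 → ℝ)) (fun s => (G s).map (RCLike.im : 𝕜 → ℝ)) P

theorem isStandardNormal_real_iff (G : S → Matrix (Fin p) (Fin q) ℝ) (P : Measure S) :
    IsStandardNormal G P ↔ IsRealStandardNormal G P :=
  ⟨fun h => h.re, fun h => ⟨h, fun h0 => absurd rfl h0, fun h0 => absurd rfl h0⟩⟩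

theorem isStandardNormal_complex_iff (G : S → Matrix (Fin p) (Fin q) ℂ) (P : Measure S) :
    IsStandardNormal G P ↔ ∃ G₁ G₂ : S → Matrix (Fin p) (Fin q) ℝ,
      (∀ s, G s = (G₁ s).map Complex.ofReal + Complex.I • (G₂ s).map Complex.ofReal) ∧
      IsRealStandardNormal G₁ P ∧ IsRealStandardNormal G₂ P ∧ IndepFun G₁ G₂ P := by
  constructor
  · intro h
    refine ⟨fun s => (G s).map RCLike.re, fun s => (G s).map RCLike.im, fun s => ?_,
      h.re, h.im Complex.I_ne_zero, h.indep Complex.I_ne_zero⟩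
    ext i j
    simp [mul_comm Complex.I, Complex.re_add_im]
  · rintro ⟨G₁, G₂, hG, h₁, h₂, h⟩
    have e₁ : (fun s => (G s).map (RCLike.re : ℂ → ℝ)) = G₁ := by
      funext s; ext i j; simp [hG s]
    have e₂ : (fun s => (G s).map (RCLike.im : ℂ → ℝ)) = G₂ := by
      funext s; ext i j; simp [hG s]
    exact ⟨by rw [e₁]; exact h₁, fun _ => by rw [e₂]; exact h₂, fun _ => by rw [e₁, e₂]; exact h⟩

end StandardNormal

/-! ## The field parameter `α`, the function `f`, and the eligible indices -/

section Parameters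

variable (𝕜 : Type*) [RCLike 𝕜]

open Classical in
/-- `α(ℝ) = 1` and `α(ℂ) = 0`. -/
def fieldAlpha : ℕ := if (RCLike.I : 𝕜) = 0 then 1 else 0

theorem fieldAlpha_real : fieldAlpha ℝ = 1 := if_pos rfl

theorem fieldAlpha_complex : fieldAlpha ℂ = 0 := if_neg Complex.I_ne_zero

/-- `f(s,t) = s / (t - s - α)`, used for `t > s + α`. -/
def fRatio (s t : ℕ) : ℝ := (s : ℝ) / ((t : ℝ) - (s : ℝ) - (fieldAlpha 𝕜 : ℝ))

/-- The natural numbers `ϱ` with `ϱ < k - α`. -/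
def eligible (k : ℕ) : Finset ℕ := {ϱ ∈ Finset.range k | ϱ + fieldAlpha 𝕜 < k}

theorem mem_eligible {k ϱ : ℕ} : ϱ ∈ eligible 𝕜 k ↔ ϱ + fieldAlpha 𝕜 < k := by
  simp only [eligible, Finset.mem_filter, Finset.mem_range]
  omega

variable {𝕜} in
theorem eligible_nonempty {k : ℕ} (hk : fieldAlpha 𝕜 < k) : (eligible 𝕜 k).Nonempty :=
  ⟨0, (mem_eligible 𝕜).2 (by omega)⟩

end Parameters

end

end SketchLowRank

open SketchLowRank

namespace SketchLowRank

noncomputable section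

/-! ### Frobenius geometry, orthonormal frames, and rows of the pseudoinverse. -/

section LinearAlgebra

variable {𝕜 : Type*} [RCLike 𝕜] {m n p q r : ℕ}

/-! Both error factors come from one estimate, `lintegral_frobSq_sub_le`. Let V have r orthonormal
columns, VᴴC = 0, and let G be standard normal with p > r + α rows. Then C and V(GV)†GC are
orthogonal, so the squared norm of C - V(GV)†GC is ‖C‖² + ‖(GV)†GC‖². As VᴴC = 0, the matrices X =
GV and GC = ZC are independent; averaging over Z gives β‖X†‖²‖C‖², with β the real dimension of 𝕜,
and β E‖X†‖² ≤ f(r,p). The mean is thus at most (1 + f(r,p))‖C‖².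

The estimate is used twice. With Q frozen, take V = Q, G = Ψ, C = A - QQᴴA: almost surely ΨQ has
full column rank, and then A - Â = C - Q(ΨQ)†ΨC. For the range finder take G = Ωᴴ, V an orthonormal
basis of the row space of a competitor B of rank at most ϱ, and C = (1 - VVᴴ)Aᴴ, so ‖C‖ ≤ ‖A - B‖.
The adjoint of the resulting residual differs from A by a matrix with columns in the range of AΩ,
hence of Q, so ‖A - QQᴴA‖ is no larger (`frobSq_sub_projection_le`). Independence of Ω and Ψ chains
the two bounds, and the infimum over B produces the tail energy; singular values never enter.

E‖X†‖² is bounded row by row. Row j of X† has length at most 1/‖h‖, where h holds the coordinates of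
column j of X along q = p - r + 1 orthonormal vectors orthogonal to the other columns
(`pinv_row_bound`). Those vectors do not depend on column j, so h is a standard normal vector and
E‖h‖⁻² = 1/(βq - 2) (`lintegral_inv_frobSq`). Finiteness of this moment also gives h ≠ 0 almost
surely, hence full column rank. All distributional identities are read off the characteristic
function exp(-‖T‖²/2). -/

theorem frobSq_nonneg (M : Matrix (Fin m) (Fin n) 𝕜) : 0 ≤ frobSq M :=
  Finset.sum_nonneg fun _ _ => Finset.sum_nonneg fun _ _ => by positivity

theorem eq_zero_of_frobSq_eq_zero {M : Matrix (Fin m) (Fin n) 𝕜} (h : frobSq M = 0) : M = 0 := by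
  unfold frobSq at h
  rw [Finset.sum_eq_zero_iff_of_nonneg (fun _ _ => Finset.sum_nonneg fun _ _ => by positivity)] at h
  ext i j
  have h2 := h i (Finset.mem_univ _)
  rw [Finset.sum_eq_zero_iff_of_nonneg (fun _ _ => by positivity)] at h2
  simpa using h2 j (Finset.mem_univ _)

/-- The real inner product `Re tr(Tᴴ M)` of two matrices. -/
def rePair (T M : Matrix (Fin m) (Fin n) 𝕜) : ℝ := RCLike.re (Tᴴ * M).trace

theorem rePair_eq_sum (T M : Matrix (Fin m) (Fin n) 𝕜) :
    rePair T M = ∑ i, ∑ j, (RCLike.re (T i j) * RCLike.re (M i j) +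
      RCLike.im (T i j) * RCLike.im (M i j)) := by
  simp only [rePair, Matrix.trace, Matrix.diag, Matrix.mul_apply, map_sum,
    Matrix.conjTranspose_apply]
  rw [Finset.sum_comm]
  refine Finset.sum_congr rfl fun i _ => Finset.sum_congr rfl fun j _ => ?_
  simp [RCLike.mul_re]

theorem frobSq_eq_rePair (M : Matrix (Fin m) (Fin n) 𝕜) : frobSq M = rePair M M := by
  rw [rePair_eq_sum]
  refine Finset.sum_congr rfl fun i _ => Finset.sum_congr rfl fun j _ => ?_
  rw [← RCLike.normSq_eq_def', RCLike.normSq_apply]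

theorem rePair_add_left (S T M : Matrix (Fin m) (Fin n) 𝕜) :
    rePair (S + T) M = rePair S M + rePair T M := by
  simp [rePair, Matrix.conjTranspose_add, Matrix.add_mul]

theorem rePair_add_right (S T M : Matrix (Fin m) (Fin n) 𝕜) :
    rePair M (S + T) = rePair M S + rePair M T := by
  simp [rePair, Matrix.mul_add]

theorem rePair_smul_right (c : ℝ) (T M : Matrix (Fin m) (Fin n) 𝕜) :
    rePair T (c • M) = c * rePair T M := by
  simp [rePair, RCLike.smul_re]

theorem rePair_comm (T M : Matrix (Fin m) (Fin n) 𝕜) : rePair T M = rePair M T := by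
  simp only [rePair_eq_sum, mul_comm]

theorem rePair_smul_left (c : ℝ) (T M : Matrix (Fin m) (Fin n) 𝕜) :
    rePair (c • T) M = c * rePair T M := by
  rw [rePair_comm, rePair_smul_right, rePair_comm]

theorem rePair_mul_left (V : Matrix (Fin m) (Fin p) 𝕜) (T : Matrix (Fin m) (Fin n) 𝕜)
    (M : Matrix (Fin p) (Fin n) 𝕜) : rePair T (V * M) = rePair (Vᴴ * T) M := by
  simp [rePair, Matrix.conjTranspose_mul, Matrix.mul_assoc]

theorem rePair_mul_right (V : Matrix (Fin p) (Fin n) 𝕜) (T : Matrix (Fin m) (Fin n) 𝕜)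
    (M : Matrix (Fin m) (Fin p) 𝕜) : rePair T (M * V) = rePair (T * Vᴴ) M := by
  simp only [rePair, Matrix.conjTranspose_mul, Matrix.conjTranspose_conjTranspose]
  rw [← Matrix.mul_assoc, Matrix.trace_mul_comm, Matrix.mul_assoc]

theorem rePair_conjTranspose (T M : Matrix (Fin m) (Fin n) 𝕜) :
    rePair Tᴴ Mᴴ = rePair T M := by
  rw [rePair_eq_sum, rePair_eq_sum, Finset.sum_comm]
  simp

theorem frobSq_conjTranspose (M : Matrix (Fin m) (Fin n) 𝕜) : frobSq Mᴴ = frobSq M := by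
  rw [frobSq_eq_rePair, rePair_conjTranspose, frobSq_eq_rePair]

theorem frobSq_neg (M : Matrix (Fin m) (Fin n) 𝕜) : frobSq (-M) = frobSq M := by
  simp [frobSq]

theorem frobSq_smul (c : ℝ) (M : Matrix (Fin m) (Fin n) 𝕜) :
    frobSq (c • M) = c ^ 2 * frobSq M := by
  rw [frobSq_eq_rePair, rePair_smul_left, rePair_smul_right, ← frobSq_eq_rePair]; ring

theorem frobSq_add_of_orthogonal {M N : Matrix (Fin m) (Fin n) 𝕜} (h : Mᴴ * N = 0) :
    frobSq (M + N) = frobSq M + frobSq N := by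
  have h1 : rePair M N = 0 := by simp [rePair, h]
  simp only [frobSq_eq_rePair, rePair_add_left, rePair_add_right, rePair_comm N M, h1]
  ring

theorem frobSq_sub_of_orthogonal {M N : Matrix (Fin m) (Fin n) 𝕜} (h : Mᴴ * N = 0) :
    frobSq (M - N) = frobSq M + frobSq N := by
  rw [sub_eq_add_neg, frobSq_add_of_orthogonal (by simp [h]), frobSq_neg]

theorem frobSq_isometry_mul {V : Matrix (Fin m) (Fin p) 𝕜} (hV : Vᴴ * V = 1)
    (M : Matrix (Fin p) (Fin n) 𝕜) : frobSq (V * M) = frobSq M := by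
  rw [frobSq_eq_rePair, rePair_mul_left, ← Matrix.mul_assoc, hV, Matrix.one_mul,
    frobSq_eq_rePair]

theorem frobSq_eq_add_of_projection {E : Matrix (Fin m) (Fin m) 𝕜} (hE : Eᴴ = E) (hE2 : E * E = E)
    (M : Matrix (Fin m) (Fin n) 𝕜) :
    frobSq M = frobSq (E * M) + frobSq (M - E * M) := by
  rw [← frobSq_add_of_orthogonal]
  · congr 1; abel
  · rw [Matrix.conjTranspose_mul, hE, Matrix.mul_sub, Matrix.mul_assoc, Matrix.mul_assoc,
      ← Matrix.mul_assoc E E, hE2, sub_self]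

theorem frobSq_projection_mul_le {E : Matrix (Fin m) (Fin m) 𝕜} (hE : Eᴴ = E) (hE2 : E * E = E)
    (M : Matrix (Fin m) (Fin n) 𝕜) : frobSq (E * M) ≤ frobSq M := by
  rw [frobSq_eq_add_of_projection hE hE2 M]
  linarith [frobSq_nonneg (M - E * M)]

theorem frobSq_sub_projection_mul_le {E : Matrix (Fin m) (Fin m) 𝕜} (hE : Eᴴ = E)
    (hE2 : E * E = E) (M : Matrix (Fin m) (Fin n) 𝕜) : frobSq (M - E * M) ≤ frobSq M := by
  rw [frobSq_eq_add_of_projection hE hE2 M]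
  linarith [frobSq_nonneg (E * M)]

theorem frobSq_mul_projection_le {E : Matrix (Fin n) (Fin n) 𝕜} (hE : Eᴴ = E) (hE2 : E * E = E)
    (M : Matrix (Fin m) (Fin n) 𝕜) : frobSq (M * E) ≤ frobSq M := by
  rw [← frobSq_conjTranspose, ← frobSq_conjTranspose M, Matrix.conjTranspose_mul, hE]
  exact frobSq_projection_mul_le hE hE2 _

theorem isometry_projection_conjTranspose (V : Matrix (Fin m) (Fin p) 𝕜) :
    (V * Vᴴ)ᴴ = V * Vᴴ := by simp

theorem isometry_projection_mul_self {V : Matrix (Fin m) (Fin p) 𝕜} (hV : Vᴴ * V = 1) :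
    (V * Vᴴ) * (V * Vᴴ) = V * Vᴴ := by
  rw [Matrix.mul_assoc, ← Matrix.mul_assoc Vᴴ, hV, Matrix.one_mul]

theorem frobSq_row (M : Matrix (Fin m) (Fin n) 𝕜) :
    frobSq M = ∑ i, frobSq (Matrix.of fun (_ : Fin 1) => M i) := by
  simp [frobSq]

/-- A subspace of `𝕜^m` of dimension `r` is the column space of a matrix with `r` orthonormal
columns. -/
theorem exists_isometry_of_submodule (S : Submodule 𝕜 (EuclideanSpace 𝕜 (Fin m))) :
    ∃ V : Matrix (Fin m) (Fin (Module.finrank 𝕜 S)) 𝕜, Vᴴ * V = 1 ∧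
      (∀ j, WithLp.toLp 2 (fun i => V i j) ∈ S) ∧
      ∀ w : Matrix (Fin m) (Fin n) 𝕜, (∀ j, WithLp.toLp 2 (fun i => w i j) ∈ S) →
        V * (Vᴴ * w) = w := by
  let b := stdOrthonormalBasis 𝕜 S
  refine ⟨Matrix.of fun i j => (b j : EuclideanSpace 𝕜 (Fin m)) i, ?_, fun j => ?_, ?_⟩
  · ext i j
    have := orthonormal_iff_ite.1 b.orthonormal i j
    rw [Submodule.coe_inner, PiLp.inner_apply] at this
    simp only [RCLike.inner_apply'] at this
    simpa [Matrix.mul_apply, Matrix.one_apply] using this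
  · exact (b j).2
  · intro w hw
    ext i j
    have h := b.sum_repr' ⟨_, hw j⟩
    have h2 := congrArg (fun x : S => (x : EuclideanSpace 𝕜 (Fin m)) i) h
    simp only [Submodule.coe_inner, PiLp.inner_apply, RCLike.inner_apply'] at h2
    simp only [Matrix.mul_apply]
    simp at h2
    rw [← h2]
    refine Finset.sum_congr rfl fun x _ => ?_
    simp [mul_comm]

/-- Any family of `r` vectors in `𝕜^p` has `p - r` orthonormal vectors orthogonal to it. -/
theorem exists_isometry_orthogonal (hr : q + r = p) (M : Matrix (Fin p) (Fin r) 𝕜) :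
    ∃ V : Matrix (Fin p) (Fin q) 𝕜, Vᴴ * V = 1 ∧ Vᴴ * M = 0 := by
  let S : Submodule 𝕜 (EuclideanSpace 𝕜 (Fin p)) :=
    Submodule.span 𝕜 (Set.range fun j => WithLp.toLp 2 (fun i => M i j))
  have hS : Module.finrank 𝕜 S ≤ r := by
    simpa [Set.finrank] using
      finrank_range_le_card (R := 𝕜) (fun j : Fin r => WithLp.toLp 2 (fun i => M i j))
  have hadd := Submodule.finrank_add_finrank_orthogonal S
  rw [finrank_euclideanSpace_fin] at hadd
  obtain ⟨V, hV, hVS, -⟩ := exists_isometry_of_submodule (n := 0) Sᗮ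
  have hq : q ≤ Module.finrank 𝕜 Sᗮ := by omega
  -- The complement has dimension larger than q when the columns of M are dependent, so only the
  -- first q basis vectors are kept.
  refine ⟨V.submatrix id (Fin.castLE hq), ?_, ?_⟩
  · ext i j
    have := congrFun (congrFun hV (Fin.castLE hq i)) (Fin.castLE hq j)
    simpa [Matrix.mul_apply, Matrix.one_apply] using this
  · ext i j
    have h1 : WithLp.toLp 2 (fun i => M i j) ∈ S := Submodule.subset_span ⟨j, rfl⟩
    have h2 := (Submodule.mem_orthogonal' S _).1 (hVS (Fin.castLE hq i)) _ h1
    rw [PiLp.inner_apply] at h2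
    simpa [Matrix.mul_apply, mul_comm] using h2

open scoped ComplexOrder in
/-- The row space of a matrix `B` has an orthonormal basis of `rank B` vectors. -/
theorem exists_isometry_rowSpace (B : Matrix (Fin m) (Fin n) 𝕜) :
    ∃ r, r = B.rank ∧ ∃ V : Matrix (Fin n) (Fin r) 𝕜, Vᴴ * V = 1 ∧ B * (V * Vᴴ) = B := by
  let S : Submodule 𝕜 (EuclideanSpace 𝕜 (Fin n)) :=
    (Submodule.span 𝕜 (Set.range Bᴴ.col)).map
      ((WithLp.linearEquiv 2 𝕜 (Fin n → 𝕜)).symm : (Fin n → 𝕜) →ₗ[𝕜] EuclideanSpace 𝕜 (Fin n))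
  have hS : Module.finrank 𝕜 S = B.rank := by
    rw [← Matrix.rank_conjTranspose, Matrix.rank_eq_finrank_span_cols]
    exact LinearEquiv.finrank_map_eq (WithLp.linearEquiv 2 𝕜 (Fin n → 𝕜)).symm _
  obtain ⟨V, hV, -, hVS⟩ := exists_isometry_of_submodule (n := m) S
  have h : V * (Vᴴ * Bᴴ) = Bᴴ := hVS Bᴴ fun j =>
    ⟨_, Submodule.subset_span ⟨j, rfl⟩, rfl⟩
  -- The size of V is the dimension of S itself; keeping it as a variable equal to the rank avoids a
  -- cast along `hS`.
  refine ⟨_, hS, V, hV, ?_⟩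
  have := congrArg Matrix.conjTranspose h
  simpa [Matrix.conjTranspose_mul, Matrix.mul_assoc] using this

/-- If `y G` is the `j`-th unit row vector, then the `j`-th row of `G†` is no longer than `y`, and
the `j`-th row of `G† G` is that unit vector. -/
theorem pinv_row_of_left_inverse (G : Matrix (Fin p) (Fin r) 𝕜) (j : Fin r)
    (y : Matrix (Fin 1) (Fin p) 𝕜) (hy : y * G = Matrix.of fun _ i => if j = i then 1 else 0) :
    frobSq (Matrix.of fun (_ : Fin 1) => pinv G j) ≤ frobSq y ∧
      (pinv G * G) j = (1 : Matrix (Fin r) (Fin r) 𝕜) j := by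
  have hX := isMoorePenrose_pinv G
  -- Left multiplication by y G extracts row j. Row j of G† is therefore y (G G†), and G G† is an
  -- orthogonal projection, which cannot lengthen y.
  have hr : ∀ {c : ℕ} (N : Matrix (Fin r) (Fin c) 𝕜),
      (Matrix.of fun (_ : Fin 1) => N j) = y * G * N := by
    intro c N
    ext a b
    simp [hy, Matrix.mul_apply]
  refine ⟨?_, ?_⟩
  · rw [hr, Matrix.mul_assoc]
    apply frobSq_mul_projection_le hX.isHermitian_left
    rw [← Matrix.mul_assoc, hX.mul_mul_left]
  · have h := hr (pinv G * G)
    rw [Matrix.mul_assoc, ← Matrix.mul_assoc G, hX.mul_mul_left, hy] at h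
    ext i
    have := congrFun (congrFun h 0) i
    simpa [Matrix.one_apply] using this

/-- Let the columns of `V` be orthogonal to all columns of `G` but the `j`-th, and let `h = Vᴴ g`
for the `j`-th column `g`. If `h ≠ 0` then the `j`-th row of `G†` has length at most `1 / ‖h‖`. -/
theorem pinv_row_bound (G : Matrix (Fin p) (Fin r) 𝕜) (j : Fin r)
    (V : Matrix (Fin p) (Fin q) 𝕜) (hV : Vᴴ * V = 1)
    (hVG : ∀ i ≠ j, ∀ a, (Vᴴ * G) a i = 0)
    (h : Matrix (Fin q) (Fin 1) 𝕜) (hh : ∀ a, h a 0 = (Vᴴ * G) a j) (h0 : frobSq h ≠ 0) :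
    frobSq (Matrix.of fun (_ : Fin 1) => pinv G j) ≤ (frobSq h)⁻¹ ∧
      (pinv G * G) j = (1 : Matrix (Fin r) (Fin r) 𝕜) j := by
  have hsq : frobSq h = RCLike.re (hᴴ * h).trace := frobSq_eq_rePair h
  have hone : ((frobSq h : ℝ) : 𝕜) = (hᴴ * h) 0 0 := by
    simp only [Matrix.mul_apply, Matrix.conjTranspose_apply, frobSq, Finset.univ_unique,
      Finset.sum_singleton, Fin.default_eq_zero, map_sum, map_pow]
    refine Finset.sum_congr rfl fun i _ => ?_
    rw [← RCLike.conj_mul]; rfl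
  -- The witness y = ‖h‖⁻² hᴴVᴴ annihilates the other columns and sends column j to ‖h‖⁻² hᴴh = 1;
  -- its length is 1/‖h‖.
  have key := pinv_row_of_left_inverse G j ((frobSq h)⁻¹ • (hᴴ * Vᴴ)) ?_
  · refine ⟨key.1.trans (le_of_eq ?_), key.2⟩
    rw [frobSq_smul, ← Matrix.conjTranspose_mul, frobSq_conjTranspose, frobSq_isometry_mul hV]
    field_simp
  · ext a i
    rw [Matrix.smul_mul, Matrix.mul_assoc, Matrix.smul_apply, Matrix.mul_apply]
    by_cases hij : j = i
    · subst hij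
      have : ∑ x, hᴴ a x * (Vᴴ * G) x j = (frobSq h : 𝕜) := by
        rw [hone, Matrix.mul_apply]
        refine Finset.sum_congr rfl fun x _ => ?_
        rw [hh, Subsingleton.elim a 0]
      rw [this, RCLike.real_smul_eq_coe_mul, ← RCLike.ofReal_mul, inv_mul_cancel₀ h0]
      simp
    · rw [Finset.sum_eq_zero fun x _ => by rw [hVG i (Ne.symm hij), mul_zero]]
      simp [hij]

end LinearAlgebra

end

end SketchLowRank

namespace SketchLowRank

noncomputable section

/-! ### Characteristic functions and invariance of the standard normal law. -/

section GaussianMatrices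

variable {𝕜 : Type*} [RCLike 𝕜] {m n p q r : ℕ}

theorem measurable_matrix_iff {S : Type*} [MeasurableSpace S]
    {f : S → Matrix (Fin p) (Fin q) 𝕜} : Measurable f ↔ ∀ i j, Measurable fun s => f s i j :=
  (measurable_pi_iff (g := fun s => (f s : Fin p → Fin q → 𝕜))).trans
    (forall_congr' fun _ => measurable_pi_iff)

theorem measurable_entry (i : Fin p) (j : Fin q) :
    Measurable fun M : Matrix (Fin p) (Fin q) 𝕜 => M i j :=
  measurable_matrix_iff.1 measurable_id i j

theorem _root_.Measurable.matrix_mul {S : Type*} [MeasurableSpace S]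
    {f : S → Matrix (Fin p) (Fin q) 𝕜} {g : S → Matrix (Fin q) (Fin r) 𝕜}
    (hf : Measurable f) (hg : Measurable g) : Measurable fun s => f s * g s := by
  rw [measurable_matrix_iff] at *
  intro i j
  simp only [Matrix.mul_apply]
  exact Finset.measurable_fun_sum _ fun a _ => (hf i a).mul (hg a j)

theorem _root_.Measurable.matrix_add {S : Type*} [MeasurableSpace S]
    {f g : S → Matrix (Fin p) (Fin q) 𝕜}
    (hf : Measurable f) (hg : Measurable g) : Measurable fun s => f s + g s := by
  rw [measurable_matrix_iff] at *
  exact fun i j => (hf i j).add (hg i j)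

theorem _root_.Measurable.matrix_sub {S : Type*} [MeasurableSpace S]
    {f g : S → Matrix (Fin p) (Fin q) 𝕜}
    (hf : Measurable f) (hg : Measurable g) : Measurable fun s => f s - g s := by
  rw [measurable_matrix_iff] at *
  exact fun i j => (hf i j).sub (hg i j)

theorem _root_.Measurable.matrix_conjTranspose {S : Type*} [MeasurableSpace S]
    {f : S → Matrix (Fin p) (Fin q) 𝕜} (hf : Measurable f) : Measurable fun s => (f s)ᴴ := by
  rw [measurable_matrix_iff] at *
  exact fun i j => RCLike.continuous_conj.measurable.comp (hf j i)

theorem measurable_frobSq : Measurable (frobSq : Matrix (Fin p) (Fin q) 𝕜 → ℝ) := by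
  unfold frobSq
  exact Finset.measurable_fun_sum _ fun i _ => Finset.measurable_fun_sum _ fun j _ =>
    ((measurable_entry i j).norm.pow_const 2)

theorem measurable_rePair (T : Matrix (Fin p) (Fin q) 𝕜) : Measurable (rePair T) := by
  have : rePair T = fun M => ∑ i, ∑ j, (RCLike.re (T i j) * RCLike.re (M i j) +
      RCLike.im (T i j) * RCLike.im (M i j)) := funext (rePair_eq_sum T)
  rw [this]
  exact Finset.measurable_fun_sum _ fun i _ => Finset.measurable_fun_sum _ fun j _ =>
    ((RCLike.measurable_re.comp (measurable_entry i j)).const_mul _).add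
      ((RCLike.measurable_im.comp (measurable_entry i j)).const_mul _)

/-- Finite measures on matrices with the same characteristic function are equal. -/
theorem ext_of_integral_rePair {μ ν : Measure (Matrix (Fin p) (Fin q) 𝕜)} [IsFiniteMeasure μ]
    [IsFiniteMeasure ν]
    (h : ∀ T, ∫ M, Complex.exp (rePair T M * Complex.I) ∂μ =
      ∫ M, Complex.exp (rePair T M * Complex.I) ∂ν) : μ = ν := by
  let L : (Fin p → Fin q → 𝕜) →ₗ[ℝ] (Fin p → Fin q → 𝕜) →ₗ[ℝ] ℝ :=
    LinearMap.mk₂ ℝ (fun M T => rePair (T : Matrix (Fin p) (Fin q) 𝕜) M)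
      (fun M N T => rePair_add_right (M : Matrix (Fin p) (Fin q) 𝕜) N T)
      (fun c M T => rePair_smul_right c (T : Matrix (Fin p) (Fin q) 𝕜) M)
      (fun M S T => rePair_add_left (S : Matrix (Fin p) (Fin q) 𝕜) T M)
      (fun c M T => rePair_smul_left c (T : Matrix (Fin p) (Fin q) 𝕜) M)
  have hLa : ∀ M T : Fin p → Fin q → 𝕜, L M T = rePair (T : Matrix (Fin p) (Fin q) 𝕜) M :=
    fun _ _ => rfl
  let μ' : Measure (Fin p → Fin q → 𝕜) := μ
  let ν' : Measure (Fin p → Fin q → 𝕜) := ν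
  have : IsFiniteMeasure μ' := ‹IsFiniteMeasure μ›
  have : IsFiniteMeasure ν' := ‹IsFiniteMeasure ν›
  refine ext_of_integral_char_eq (P := μ') (P' := ν') (V := Fin p → Fin q → 𝕜) (L := L) (e := Real.probChar)
    Real.continuous_probChar Real.probChar_ne_one ?_ ?_ ?_
  -- The pairing is nondegenerate because pairing M with itself gives ‖M‖².
  · intro M hM h0
    apply hM
    refine eq_zero_of_frobSq_eq_zero (M := (M : Matrix (Fin p) (Fin q) 𝕜)) ?_
    exact (frobSq_eq_rePair (M : Matrix (Fin p) (Fin q) 𝕜)).trans (LinearMap.congr_fun h0 M)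
  · have hL : (fun z : (Fin p → Fin q → 𝕜) × (Fin p → Fin q → 𝕜) => L z.1 z.2) =
        fun z => ∑ i, ∑ j, (RCLike.re (z.2 i j) * RCLike.re (z.1 i j) +
          RCLike.im (z.2 i j) * RCLike.im (z.1 i j)) := funext fun z => rePair_eq_sum _ _
    rw [hL]
    fun_prop
  · intro T
    exact h T

variable (𝕜) in
/-- The standard normal distribution on `𝕜`: independent `N(0,1)` real and (over `ℂ`) imaginary
parts. -/
def stdNormal : Measure 𝕜 :=
  ((gaussianReal 0 1).prod (gaussianReal 0 1)).map fun z => (z.1 : 𝕜) + (z.2 : 𝕜) * RCLike.I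

theorem measurable_ofReal_add_mul_I :
    Measurable fun z : ℝ × ℝ => (z.1 : 𝕜) + (z.2 : 𝕜) * RCLike.I := by
  fun_prop

instance : IsProbabilityMeasure (stdNormal 𝕜) :=
  Measure.isProbabilityMeasure_map measurable_ofReal_add_mul_I.aemeasurable

theorem integral_exp_gaussianReal (a : ℝ) :
    ∫ x, Complex.exp ((a * x : ℝ) * Complex.I) ∂gaussianReal 0 1 =
      Complex.exp (-((a ^ 2 : ℝ) / 2)) := by
  have := charFun_gaussianReal (μ := 0) (v := 1) a
  rw [charFun_apply_real] at this
  simp only [Complex.ofReal_mul]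
  rw [this]
  simp

theorem integral_exp_stdNormal (t : 𝕜) :
    ∫ x, Complex.exp ((RCLike.re t * RCLike.re x + RCLike.im t * RCLike.im x : ℝ) * Complex.I)
      ∂stdNormal 𝕜 = Complex.exp (-((‖t‖ ^ 2 : ℝ) / 2)) := by
  rw [stdNormal, integral_map measurable_ofReal_add_mul_I.aemeasurable (by fun_prop)]
  have h1 : ∀ z : ℝ × ℝ, Complex.exp ((RCLike.re t * RCLike.re ((z.1 : 𝕜) + (z.2 : 𝕜) * RCLike.I) +
      RCLike.im t * RCLike.im ((z.1 : 𝕜) + (z.2 : 𝕜) * RCLike.I) : ℝ) * Complex.I) =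
      Complex.exp ((RCLike.re t * z.1 : ℝ) * Complex.I) *
        Complex.exp ((RCLike.im t * z.2 : ℝ) * Complex.I) := by
    intro z
    rw [← Complex.exp_add]
    simp only [map_add, RCLike.ofReal_re, RCLike.re_ofReal_mul, RCLike.I_re, RCLike.ofReal_im,
      RCLike.im_ofReal_mul, mul_zero, add_zero, zero_add]
    rw [show RCLike.im t * (z.2 * RCLike.im (RCLike.I : 𝕜)) = RCLike.im t * z.2 by
      rcases RCLike.I_eq_zero_or_im_I_eq_one (K := 𝕜) with h | h
      · rw [RCLike.im_eq_zero h t]; simp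
      · rw [h, mul_one]]
    push_cast
    ring_nf
  simp_rw [h1]
  rw [integral_prod_mul (fun x : ℝ => Complex.exp ((RCLike.re t * x : ℝ) * Complex.I))
    (fun x : ℝ => Complex.exp ((RCLike.im t * x : ℝ) * Complex.I)),
    integral_exp_gaussianReal, integral_exp_gaussianReal, ← Complex.exp_add,
    ← RCLike.normSq_eq_def', RCLike.normSq_apply]
  congr 1
  push_cast
  ring

variable (𝕜) in
/-- The standard normal distribution on `p × q` matrices. -/
def stdNormalMatrix (p q : ℕ) : Measure (Matrix (Fin p) (Fin q) 𝕜) :=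
  Measure.pi (fun _ : Fin p => Measure.pi (fun _ : Fin q => stdNormal 𝕜))

instance : IsProbabilityMeasure (stdNormalMatrix 𝕜 p q) :=
  inferInstanceAs (IsProbabilityMeasure
    (Measure.pi (fun _ : Fin p => Measure.pi (fun _ : Fin q => stdNormal 𝕜))))

theorem integral_prod_stdNormalMatrix {K : Type*} [RCLike K] (f : Fin p → Fin q → 𝕜 → K) :
    ∫ M, ∏ i, ∏ j, f i j (M i j) ∂stdNormalMatrix 𝕜 p q =
      ∏ i, ∏ j, ∫ x, f i j x ∂stdNormal 𝕜 := by
  refine (integral_fintype_prod_eq_prod (E := fun _ : Fin p => Fin q → 𝕜)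
    (fun i x => ∏ j, f i j (x j))).trans ?_
  exact Finset.prod_congr rfl fun i _ => integral_fintype_prod_eq_prod (fun j x => f i j x)

/-- The exponential factors over the independent entries. The result depends on T only through its
Frobenius norm, which is the source of every invariance used later. -/
theorem integral_exp_stdNormalMatrix (T : Matrix (Fin p) (Fin q) 𝕜) :
    ∫ M, Complex.exp (rePair T M * Complex.I) ∂stdNormalMatrix 𝕜 p q =
      Complex.exp (-((frobSq T : ℝ) / 2)) := by
  simp only [rePair_eq_sum, frobSq, Complex.ofReal_sum, Finset.sum_mul, Complex.exp_sum,
    Finset.sum_div, ← Finset.sum_neg_distrib]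
  rw [integral_prod_stdNormalMatrix (fun i j x => Complex.exp
    (((RCLike.re (T i j) * RCLike.re x + RCLike.im (T i j) * RCLike.im x : ℝ) : ℂ) * Complex.I))]
  simp only [integral_exp_stdNormal]

theorem eq_stdNormalMatrix {μ : Measure (Matrix (Fin p) (Fin q) 𝕜)} [IsFiniteMeasure μ]
    (h : ∀ T, ∫ M, Complex.exp (rePair T M * Complex.I) ∂μ =
      Complex.exp (-((frobSq T : ℝ) / 2))) : μ = stdNormalMatrix 𝕜 p q :=
  ext_of_integral_rePair fun T => by rw [h, integral_exp_stdNormalMatrix]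

theorem aestronglyMeasurable_exp_rePair (T : Matrix (Fin p) (Fin q) 𝕜)
    (μ : Measure (Matrix (Fin p) (Fin q) 𝕜)) :
    AEStronglyMeasurable (fun M => Complex.exp (rePair T M * Complex.I)) μ :=
  (Complex.measurable_exp.comp ((Complex.measurable_ofReal.comp
    (measurable_rePair T)).mul_const _)).aestronglyMeasurable

/-- A map whose adjoint is isometric preserves the standard normal distribution. -/
theorem map_stdNormalMatrix {L : Matrix (Fin p) (Fin q) 𝕜 → Matrix (Fin m) (Fin n) 𝕜}
    (hL : Measurable L) (L' : Matrix (Fin m) (Fin n) 𝕜 → Matrix (Fin p) (Fin q) 𝕜)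
    (hadj : ∀ T M, rePair T (L M) = rePair (L' T) M) (hiso : ∀ T, frobSq (L' T) = frobSq T) :
    (stdNormalMatrix 𝕜 p q).map L = stdNormalMatrix 𝕜 m n := by
  have := Measure.isProbabilityMeasure_map (μ := stdNormalMatrix 𝕜 p q) hL.aemeasurable
  refine eq_stdNormalMatrix fun T => ?_
  rw [integral_map hL.aemeasurable (aestronglyMeasurable_exp_rePair _ _)]
  simp_rw [hadj, integral_exp_stdNormalMatrix, hiso]

/-- A map out of a product whose adjoint is isometric preserves the standard normal
distribution. -/
theorem map_prod_stdNormalMatrix {p' q' : ℕ}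
    {L : Matrix (Fin p) (Fin q) 𝕜 × Matrix (Fin p') (Fin q') 𝕜 → Matrix (Fin m) (Fin n) 𝕜}
    (hL : Measurable L) (L₁ : Matrix (Fin m) (Fin n) 𝕜 → Matrix (Fin p) (Fin q) 𝕜)
    (L₂ : Matrix (Fin m) (Fin n) 𝕜 → Matrix (Fin p') (Fin q') 𝕜)
    (hadj : ∀ T M N, rePair T (L (M, N)) = rePair (L₁ T) M + rePair (L₂ T) N)
    (hiso : ∀ T, frobSq (L₁ T) + frobSq (L₂ T) = frobSq T) :
    ((stdNormalMatrix 𝕜 p q).prod (stdNormalMatrix 𝕜 p' q')).map L = stdNormalMatrix 𝕜 m n := by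
  have := Measure.isProbabilityMeasure_map
    (μ := (stdNormalMatrix 𝕜 p q).prod (stdNormalMatrix 𝕜 p' q')) hL.aemeasurable
  refine eq_stdNormalMatrix fun T => ?_
  rw [integral_map hL.aemeasurable (aestronglyMeasurable_exp_rePair _ _)]
  have h1 : ∀ z : Matrix (Fin p) (Fin q) 𝕜 × Matrix (Fin p') (Fin q') 𝕜,
      Complex.exp (rePair T (L z) * Complex.I) =
        Complex.exp (rePair (L₁ T) z.1 * Complex.I) *
          Complex.exp (rePair (L₂ T) z.2 * Complex.I) := by
    rintro ⟨M, N⟩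
    rw [hadj, ← Complex.exp_add]
    push_cast
    ring_nf
  simp_rw [h1]
  rw [integral_prod_mul (fun M => Complex.exp (rePair (L₁ T) M * Complex.I))
    (fun M => Complex.exp (rePair (L₂ T) M * Complex.I)),
    integral_exp_stdNormalMatrix, integral_exp_stdNormalMatrix, ← Complex.exp_add, ← hiso T]
  congr 1
  push_cast
  ring

/-- The distribution of a standard normal matrix. -/
theorem IsStandardNormal.map_eq {S : Type*} [MeasurableSpace S] {P : Measure S}
    [IsProbabilityMeasure P] {G : S → Matrix (Fin p) (Fin q) 𝕜} (hG : IsStandardNormal G P) :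
    AEMeasurable G P ∧ P.map G = stdNormalMatrix 𝕜 p q := by
  have hre : ∀ i j, AEMeasurable (fun s => RCLike.re (G s i j)) P := fun i j =>
    (hG.re.law (i, j)).aemeasurable
  have him : ∀ i j, AEMeasurable (fun s => RCLike.im (G s i j)) P := by
    intro i j
    by_cases h : (RCLike.I : 𝕜) = 0
    · simp only [RCLike.im_eq_zero h]; fun_prop
    · exact (hG.im h |>.law (i, j)).aemeasurable
  have hmeas : AEMeasurable G P := by
    refine aemeasurable_pi_lambda (fun s => (G s : Fin p → Fin q → 𝕜)) fun i =>
      aemeasurable_pi_lambda _ fun j => ?_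
    have : (fun s => G s i j) = fun s =>
        ((RCLike.re (G s i j) : ℝ) : 𝕜) + ((RCLike.im (G s i j) : ℝ) : 𝕜) * RCLike.I :=
      funext fun s => (RCLike.re_add_im _).symm
    rw [this]
    have h1 := hre i j
    have h2 := him i j
    fun_prop
  refine ⟨hmeas, ?_⟩
  have := Measure.isProbabilityMeasure_map (μ := P) hmeas
  have key : ∀ (X : S → Matrix (Fin p) (Fin q) ℝ), IsRealStandardNormal X P →
      ∀ T : Matrix (Fin p) (Fin q) ℝ,
      ∫ s, Complex.exp ((∑ i, ∑ j, T i j * X s i j : ℝ) * Complex.I) ∂P =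
        Complex.exp (-((∑ i, ∑ j, T i j ^ 2 : ℝ) / 2)) := by
    intro X hX T
    have := hX.indep.integral_fun_prod_comp (fun e => (hX.law e).aemeasurable)
      (f := fun e x => Complex.exp ((T e.1 e.2 * x : ℝ) * Complex.I))
      (fun e => by fun_prop)
    simp only [← Finset.sum_product', Finset.univ_product_univ, Complex.ofReal_sum,
      Finset.sum_mul, Complex.exp_sum, Finset.sum_div, ← Finset.sum_neg_distrib]
    rw [this]
    refine Finset.prod_congr rfl fun e _ => ?_
    rw [← integral_exp_gaussianReal, ← (hX.law e).map_eq, integral_map (hX.law e).aemeasurable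
      (by fun_prop)]
  refine eq_stdNormalMatrix fun T => ?_
  rw [integral_map hmeas (aestronglyMeasurable_exp_rePair _ _)]
  have hfrob : frobSq T = (∑ i, ∑ j, RCLike.re (T i j) ^ 2) + ∑ i, ∑ j, RCLike.im (T i j) ^ 2 := by
    rw [frobSq_eq_rePair, rePair_eq_sum]
    simp only [← Finset.sum_add_distrib, sq]
  have hpair : ∀ s, Complex.exp (rePair T (G s) * Complex.I) =
      Complex.exp ((∑ i, ∑ j, RCLike.re (T i j) * RCLike.re (G s i j) : ℝ) * Complex.I) *
      Complex.exp ((∑ i, ∑ j, RCLike.im (T i j) * RCLike.im (G s i j) : ℝ) * Complex.I) := by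
    intro s
    rw [rePair_eq_sum, ← Complex.exp_add, ← add_mul, ← Complex.ofReal_add]
    simp only [← Finset.sum_add_distrib]
  simp_rw [hpair]
  -- Over ℝ the imaginary factor is identically 1; over ℂ independence of the two parts splits the
  -- expectation.
  by_cases h : (RCLike.I : 𝕜) = 0
  · have hz : ∀ x : 𝕜, RCLike.im x = 0 := RCLike.im_eq_zero h
    simp only [hfrob, hz]
    simpa using key _ hG.re (T.map RCLike.re)
  · have hind := hG.indep h
    have hm : ∀ T : Matrix (Fin p) (Fin q) ℝ, Measurable fun X : Matrix (Fin p) (Fin q) ℝ =>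
        Complex.exp ((∑ i, ∑ j, T i j * X i j : ℝ) * Complex.I) := by
      intro T
      refine Complex.measurable_exp.comp ((Complex.measurable_ofReal.comp ?_).mul_const _)
      exact Finset.measurable_fun_sum _ fun i _ => Finset.measurable_fun_sum _ fun j _ =>
        (measurable_entry i j).const_mul _
    have aemeas : ∀ {f : 𝕜 → ℝ}, (∀ i j, AEMeasurable (fun s => f (G s i j)) P) →
        AEMeasurable (fun s => (G s).map f) P := fun hf =>
      aemeasurable_pi_lambda _ fun i => aemeasurable_pi_lambda _ fun j => hf i j
    have := hind.integral_fun_comp_mul_comp (aemeas hre) (aemeas him)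
      (hm (T.map RCLike.re)).aestronglyMeasurable (hm (T.map RCLike.im)).aestronglyMeasurable
    simp only [Matrix.map_apply] at this
    have e1 := key _ hG.re (T.map RCLike.re)
    have e2 := key _ (hG.im h) (T.map RCLike.im)
    simp only [Matrix.map_apply] at e1 e2
    rw [this, e1, e2, hfrob, ← Complex.exp_add]
    congr 1
    push_cast
    ring

theorem map_conjTranspose_stdNormalMatrix :
    (stdNormalMatrix 𝕜 p q).map Matrix.conjTranspose = stdNormalMatrix 𝕜 q p :=
  map_stdNormalMatrix measurable_id.matrix_conjTranspose Matrix.conjTranspose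
    (fun T M => by rw [← rePair_conjTranspose, Matrix.conjTranspose_conjTranspose])
    frobSq_conjTranspose

end GaussianMatrices

end

end SketchLowRank

namespace SketchLowRank

noncomputable section

/-! ### Measurability of the pseudoinverse. -/

section Pseudoinverse

variable {𝕜 : Type*} [RCLike 𝕜] {m n p q r : ℕ}

instance instBorelSpaceMatrix : BorelSpace (Matrix (Fin p) (Fin q) 𝕜) :=
  inferInstanceAs (BorelSpace (Fin p → Fin q → 𝕜))

open scoped ComplexOrder in
theorem isUnit_det_gram_add_smul (A : Matrix (Fin m) (Fin n) 𝕜) {t : ℝ} (ht : 0 < t) :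
    IsUnit (Aᴴ * A + (t : 𝕜) • (1 : Matrix (Fin n) (Fin n) 𝕜)).det := by
  rw [← Matrix.isUnit_iff_isUnit_det]
  have h1 : ((t : 𝕜) • (1 : Matrix (Fin n) (Fin n) 𝕜)).PosDef :=
    Matrix.PosDef.one.smul (by exact_mod_cast ht)
  exact (Matrix.PosDef.posSemidef_add (Matrix.posSemidef_conjTranspose_mul_self A) h1).isUnit

/-- The regularized inverse `(AᴴA + t)⁻¹ Aᴴ` is close to the pseudoinverse for small `t`. -/
theorem frobSq_pinv_sub_regularized_le (A : Matrix (Fin m) (Fin n) 𝕜) {t : ℝ} (ht : 0 < t) :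
    frobSq (pinv A - (Aᴴ * A + (t : 𝕜) • (1 : Matrix (Fin n) (Fin n) 𝕜))⁻¹ * Aᴴ) ≤
      t * frobSq ((pinv A)ᴴ * pinv A) := by
  have hX := isMoorePenrose_pinv A
  set X := pinv A
  set R := Aᴴ * A + (t : 𝕜) • (1 : Matrix (Fin n) (Fin n) 𝕜) with hR
  set D := X - R⁻¹ * Aᴴ with hD
  have hKX : Aᴴ * A * X = Aᴴ := by
    have := congrArg Matrix.conjTranspose hX.mul_mul_left
    rwa [Matrix.conjTranspose_mul, hX.isHermitian_left, ← Matrix.mul_assoc] at this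
  have hXN : X = Aᴴ * (Xᴴ * X) := by
    conv_lhs => rw [← hX.mul_mul_right, ← hX.isHermitian_right, Matrix.conjTranspose_mul]
    rw [Matrix.mul_assoc]
  have hRD : R * D = t • X := by
    rw [hD, Matrix.mul_sub, ← Matrix.mul_assoc R, Matrix.mul_nonsing_inv _
      (isUnit_det_gram_add_smul A ht), Matrix.one_mul, hR, Matrix.add_mul, hKX,
      Matrix.smul_mul, Matrix.one_mul, add_sub_cancel_left]
    ext i j
    simp [RCLike.real_smul_eq_coe_mul]
  have h1 : rePair D (R * D) = frobSq (A * D) + t * frobSq D := by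
    have : R * D = Aᴴ * (A * D) + t • D := by
      rw [hR, Matrix.add_mul, Matrix.smul_mul, Matrix.one_mul, Matrix.mul_assoc]
      congr 1
      ext i j
      simp [RCLike.real_smul_eq_coe_mul]
    rw [this, rePair_add_right, rePair_smul_right, rePair_mul_left,
      Matrix.conjTranspose_conjTranspose, ← frobSq_eq_rePair, ← frobSq_eq_rePair]
  have h2 : rePair D (R * D) = t * rePair (A * D) (Xᴴ * X) := by
    rw [hRD, rePair_smul_right]
    conv_lhs => rw [hXN]
    rw [rePair_mul_left, Matrix.conjTranspose_conjTranspose]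
  -- Completing the square: `h1` and `h2` give t‖D‖² = t⟨AD, XᴴX⟩ - ‖AD‖², at most (t²/4)‖XᴴX‖². The
  -- stated bound drops the factor 1/4.
  have h3 := frobSq_nonneg (A * D + (-(t / 2)) • (Xᴴ * X))
  rw [frobSq_eq_rePair] at h3
  simp only [rePair_add_left, rePair_add_right, rePair_smul_left, rePair_smul_right] at h3
  rw [← frobSq_eq_rePair, ← frobSq_eq_rePair, rePair_comm (Xᴴ * X) (A * D)] at h3
  have h4 := frobSq_nonneg (Xᴴ * X)
  have h5 : t * frobSq D ≤ t * (t * frobSq (Xᴴ * X)) := by nlinarith [mul_nonneg (sq_nonneg t) h4]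
  exact le_of_mul_le_mul_left h5 ht

theorem sq_norm_entry_le_frobSq (M : Matrix (Fin m) (Fin n) 𝕜) (i : Fin m) (j : Fin n) :
    ‖M i j‖ ^ 2 ≤ frobSq M :=
  (Finset.single_le_sum (f := fun j => ‖M i j‖ ^ 2) (fun _ _ => by positivity)
    (Finset.mem_univ j)).trans
    (Finset.single_le_sum (f := fun i => ∑ j, ‖M i j‖ ^ 2)
      (fun _ _ => Finset.sum_nonneg fun _ _ => by positivity) (Finset.mem_univ i))

/-- The pseudoinverse is discontinuous where the rank drops, but it is the pointwise limit of the
regularized inverses, which are measurable by Cramer's formula. -/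
theorem measurable_pinv : Measurable (pinv : Matrix (Fin m) (Fin n) 𝕜 → _) := by
  let t : ℕ → ℝ := fun N => 1 / ((N : ℝ) + 1)
  have ht : ∀ N, 0 < t N := fun N => by positivity
  have ht0 : Filter.Tendsto t Filter.atTop (nhds 0) := tendsto_one_div_add_atTop_nhds_zero_nat
  rw [measurable_matrix_iff]
  intro i j
  let F : ℕ → Matrix (Fin m) (Fin n) 𝕜 → Matrix (Fin n) (Fin m) 𝕜 := fun N A =>
    (Aᴴ * A + ((t N : ℝ) : 𝕜) • (1 : Matrix (Fin n) (Fin n) 𝕜))⁻¹ * Aᴴ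
  refine measurable_of_tendsto_metrizable (f := fun N A => F N A i j) (fun N => ?_) ?_
  · refine measurable_matrix_iff.1 (Measurable.matrix_mul ?_ measurable_id.matrix_conjTranspose) i j
    rw [measurable_matrix_iff]
    intro a b
    have hinv : ∀ M : Matrix (Fin n) (Fin n) 𝕜, M⁻¹ a b = M.det⁻¹ * M.adjugate a b := by
      intro M
      rw [Matrix.inv_def, Ring.inverse_eq_inv', Matrix.smul_apply, smul_eq_mul]
    simp only [hinv]
    have hc : Continuous fun A : Matrix (Fin m) (Fin n) 𝕜 =>
        Aᴴ * A + ((t N : ℝ) : 𝕜) • (1 : Matrix (Fin n) (Fin n) 𝕜) := by fun_prop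
    exact hc.matrix_det.measurable.inv.mul (hc.matrix_adjugate.matrix_elem a b).measurable
  · rw [tendsto_pi_nhds]
    intro A
    rw [tendsto_iff_norm_sub_tendsto_zero]
    have hb : Filter.Tendsto (fun N => t N * frobSq ((pinv A)ᴴ * pinv A)) Filter.atTop
        (nhds 0) := by simpa using ht0.mul_const (frobSq ((pinv A)ᴴ * pinv A))
    have hs : Filter.Tendsto (fun N => ‖F N A i j - pinv A i j‖ ^ 2) Filter.atTop (nhds 0) := by
      refine squeeze_zero (fun _ => by positivity) (fun N => ?_) hb
      rw [norm_sub_rev]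
      exact (sq_norm_entry_le_frobSq (pinv A - F N A) i j).trans
        (frobSq_pinv_sub_regularized_le A (ht N))
    have := hs.sqrt
    simpa [Real.sqrt_sq] using this

end Pseudoinverse

/-! ### Second moments and the inverse moment of a Gaussian vector. -/

section GaussianIntegrals

variable {𝕜 : Type*} [RCLike 𝕜] {m n p q r : ℕ}

theorem integral_exp_neg_sq_gaussianReal {s : ℝ} (hs : 0 ≤ s) :
    ∫ x, Real.exp (-s * x ^ 2) ∂gaussianReal 0 1 = (√(1 + 2 * s))⁻¹ := by
  rw [integral_gaussianReal_eq_integral_smul one_ne_zero]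
  have h : ∀ x : ℝ, gaussianPDFReal 0 1 x • Real.exp (-s * x ^ 2) =
      (√(2 * Real.pi))⁻¹ * Real.exp (-(s + 1 / 2) * x ^ 2) := by
    intro x
    rw [gaussianPDFReal, smul_eq_mul, mul_assoc, ← Real.exp_add]
    simp only [NNReal.coe_one, mul_one, sub_zero]
    ring_nf
  simp_rw [h]
  rw [integral_const_mul, integral_gaussian, ← Real.sqrt_inv, ← Real.sqrt_inv,
    ← Real.sqrt_mul (by positivity)]
  congr 1
  have := Real.pi_pos
  field_simp
  ring

variable (𝕜) in
/-- The real dimension of `𝕜`. -/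
def realDim : ℕ := 2 - fieldAlpha 𝕜

theorem sq_norm_ofReal_add_mul_I (z : ℝ × ℝ) :
    ‖(z.1 : 𝕜) + (z.2 : 𝕜) * RCLike.I‖ ^ 2 =
      z.1 ^ 2 + if (RCLike.I : 𝕜) = 0 then 0 else z.2 ^ 2 := by
  rw [← RCLike.normSq_eq_def', RCLike.normSq_apply]
  simp only [map_add, RCLike.ofReal_re, RCLike.re_ofReal_mul, RCLike.I_re, RCLike.ofReal_im,
      RCLike.im_ofReal_mul, mul_zero, add_zero, zero_add]
  split_ifs with h
  · simp [h, sq]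
  · rw [(RCLike.I_eq_zero_or_im_I_eq_one (K := 𝕜)).resolve_left h]; ring

theorem integral_exp_neg_sq_stdNormal {s : ℝ} (hs : 0 ≤ s) :
    ∫ x, Real.exp (-s * ‖x‖ ^ 2) ∂stdNormal 𝕜 = (√(1 + 2 * s))⁻¹ ^ realDim 𝕜 := by
  rw [stdNormal, integral_map measurable_ofReal_add_mul_I.aemeasurable (by fun_prop)]
  simp only [sq_norm_ofReal_add_mul_I, realDim, fieldAlpha]
  split_ifs with h
  · have := integral_prod_mul (μ := gaussianReal 0 1) (ν := gaussianReal 0 1)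
      (fun x : ℝ => Real.exp (-s * x ^ 2)) (fun _ => (1 : ℝ))
    simp only [mul_one, integral_const, probReal_univ, smul_eq_mul,
      integral_exp_neg_sq_gaussianReal hs] at this
    simpa using this
  · have := integral_prod_mul (μ := gaussianReal 0 1) (ν := gaussianReal 0 1)
      (fun x : ℝ => Real.exp (-s * x ^ 2)) (fun x : ℝ => Real.exp (-s * x ^ 2))
    simp only [← Real.exp_add, ← mul_add] at this
    rw [this, integral_exp_neg_sq_gaussianReal hs]
    ring

theorem integral_sq_gaussianReal : ∫ x, x ^ 2 ∂gaussianReal 0 1 = 1 := by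
  have := variance_fun_id_gaussianReal (μ := 0) (v := 1)
  rw [variance_eq_integral (by fun_prop)] at this
  simpa using this

theorem integral_sq_stdNormal : ∫ x, ‖x‖ ^ 2 ∂stdNormal 𝕜 = realDim 𝕜 := by
  rw [stdNormal, integral_map measurable_ofReal_add_mul_I.aemeasurable (by fun_prop)]
  have hi : Integrable (fun x : ℝ => x ^ 2) (gaussianReal 0 1) :=
    (memLp_id_gaussianReal 2).integrable_sq
  simp only [sq_norm_ofReal_add_mul_I, realDim, fieldAlpha]
  split_ifs with h
  · simp only [add_zero]
    rw [integral_fun_fst (fun x : ℝ => x ^ 2), integral_sq_gaussianReal]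
    simp
  · rw [integral_add (hi.comp_fst _) (hi.comp_snd _),
      integral_fun_fst (fun x : ℝ => x ^ 2), integral_fun_snd (fun x : ℝ => x ^ 2)]
    simp [integral_sq_gaussianReal]
    norm_num

theorem lintegral_frobSq_stdNormalMatrix_one :
    ∫⁻ M, ENNReal.ofReal (frobSq M) ∂stdNormalMatrix 𝕜 1 1 = ENNReal.ofReal (realDim 𝕜) := by
  have h := integral_prod_stdNormalMatrix (𝕜 := 𝕜) (p := 1) (q := 1) (K := ℝ)
    (fun _ _ x => ‖x‖ ^ 2)
  simp only [Finset.univ_unique, Finset.prod_singleton, integral_sq_stdNormal] at h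
  have hf : ∀ M : Matrix (Fin 1) (Fin 1) 𝕜, frobSq M = ‖M default default‖ ^ 2 := fun M => by
    simp [frobSq]
  have hpos : (realDim 𝕜 : ℝ) ≠ 0 := by
    unfold realDim fieldAlpha
    split_ifs <;> norm_num
  simp only [hf]
  rw [← ofReal_integral_eq_lintegral_ofReal, h]
  -- A nonzero Bochner integral certifies integrability, since nonintegrable functions have integral
  -- 0.
  · exact not_imp_comm.1 integral_undef (by rw [h]; exact hpos)
  · exact Filter.Eventually.of_forall fun _ => by positivity

theorem integral_exp_neg_frobSq {s : ℝ} (hs : 0 ≤ s) :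
    ∫ h, Real.exp (-s * frobSq h) ∂stdNormalMatrix 𝕜 q 1 =
      (√(1 + 2 * s))⁻¹ ^ (realDim 𝕜 * q) := by
  have h := integral_prod_stdNormalMatrix (𝕜 := 𝕜) (p := q) (q := 1) (K := ℝ)
    (fun _ _ x => Real.exp (-s * ‖x‖ ^ 2))
  simp only [integral_exp_neg_sq_stdNormal hs, Finset.prod_const, Finset.card_univ,
    Fintype.card_fin, pow_one] at h
  rw [pow_mul, ← h]
  simp only [frobSq, Finset.mul_sum, Real.exp_sum]

/-- Turns an inverse moment into an integral of Laplace transforms. At x = 0 both sides are ∞, so no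
exceptional set is needed. -/
theorem lintegral_exp_neg_mul {x : ℝ} (hx : 0 ≤ x) :
    ∫⁻ s in Set.Ioi (0 : ℝ), ENNReal.ofReal (Real.exp (-s * x)) = (ENNReal.ofReal x)⁻¹ := by
  rcases hx.eq_or_lt with rfl | hx
  · simp
  · have hi : IntegrableOn (fun s : ℝ => Real.exp (-x * s)) (Set.Ioi 0) :=
      integrableOn_exp_mul_Ioi (by linarith) 0
    have h2 := integral_exp_mul_Ioi (a := -x) (by linarith) 0
    have h3 := ofReal_integral_eq_lintegral_ofReal hi
      (Filter.Eventually.of_forall fun _ => (Real.exp_pos _).le)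
    simp only [neg_mul, mul_comm x] at h2 h3 ⊢
    rw [← h3, h2, ← ENNReal.ofReal_inv_of_pos hx]
    simp

theorem lintegral_inv_sqrt_pow {N : ℕ} (hN : 2 < N) :
    ∫⁻ s in Set.Ioi (0 : ℝ), ENNReal.ofReal ((√(1 + 2 * s))⁻¹ ^ N) =
      ENNReal.ofReal (1 / ((N : ℝ) - 2)) := by
  obtain ⟨M, rfl⟩ : ∃ M, N = M + 3 := ⟨N - 3, by omega⟩
  -- With N = M + 3 this is the antiderivative -(1 + 2s)^(-(N-2)/2)/(N-2); it vanishes at infinity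
  -- exactly because N > 2.
  let F : ℝ → ℝ := fun s => -(1 / ((M : ℝ) + 1)) * (√(1 + 2 * s))⁻¹ ^ (M + 1)
  have hd : ∀ s ∈ Set.Ici (0 : ℝ), HasDerivAt F ((√(1 + 2 * s))⁻¹ ^ (M + 3)) s := by
    intro s hs
    have hs : (0 : ℝ) ≤ s := hs
    have hpos : 0 < 1 + 2 * s := by linarith
    have h1 : HasDerivAt (fun s : ℝ => 1 + 2 * s) 2 s := by
      simpa using ((hasDerivAt_id s).const_mul 2).const_add 1
    have h2 := ((h1.sqrt hpos.ne').inv (Real.sqrt_pos.2 hpos).ne').pow (M + 1)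
    have h3 := h2.const_mul (-(1 / ((M : ℝ) + 1)))
    refine h3.congr_deriv ?_
    have hq := (Real.sqrt_pos.2 hpos).ne'
    have hM : (M : ℝ) + 1 ≠ 0 := by positivity
    simp only [Pi.inv_apply]
    push_cast
    field_simp
    rw [add_comm M 3, pow_add, one_div, inv_pow _ 3]
    field_simp
  have hnn : ∀ s ∈ Set.Ioi (0 : ℝ), 0 ≤ (√(1 + 2 * s))⁻¹ ^ (M + 3) := fun s _ => by positivity
  have htend : Filter.Tendsto F Filter.atTop (nhds 0) := by
    have h1 : Filter.Tendsto (fun s : ℝ => 1 + 2 * s) Filter.atTop Filter.atTop :=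
      Filter.tendsto_atTop_add_const_left _ _
        (Filter.tendsto_id.const_mul_atTop (by norm_num))
    have h2 := ((Real.tendsto_sqrt_atTop.comp h1).inv_tendsto_atTop).pow (M + 1)
    have h3 := h2.const_mul (-(1 / ((M : ℝ) + 1)))
    rw [zero_pow M.succ_ne_zero, mul_zero] at h3
    exact h3
  have hint := integrableOn_Ioi_deriv_of_nonneg' hd hnn htend
  have hval := integral_Ioi_of_hasDerivAt_of_nonneg' hd hnn htend
  rw [← ofReal_integral_eq_lintegral_ofReal hint
    ((ae_restrict_iff' measurableSet_Ioi).2 (Filter.Eventually.of_forall hnn)), hval]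
  congr 1
  simp only [F]
  push_cast
  simp
  ring

/-- The inverse moment `E ‖h‖⁻²` of a standard normal vector. -/
theorem lintegral_inv_frobSq (hq : 2 < realDim 𝕜 * q) :
    ∫⁻ h, (ENNReal.ofReal (frobSq h))⁻¹ ∂stdNormalMatrix 𝕜 q 1 =
      ENNReal.ofReal (1 / ((realDim 𝕜 : ℝ) * q - 2)) := by
  simp_rw [← lintegral_exp_neg_mul (frobSq_nonneg _)]
  rw [lintegral_lintegral_swap]
  · have h1 : ∀ s ∈ Set.Ioi (0 : ℝ),
        ∫⁻ h, ENNReal.ofReal (Real.exp (-s * frobSq h)) ∂stdNormalMatrix 𝕜 q 1 =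
          ENNReal.ofReal ((√(1 + 2 * s))⁻¹ ^ (realDim 𝕜 * q)) := by
      intro s hs
      have hs : (0 : ℝ) < s := hs
      have h := integral_exp_neg_frobSq (𝕜 := 𝕜) (q := q) hs.le
      rw [← h, ofReal_integral_eq_lintegral_ofReal]
      · refine not_imp_comm.1 integral_undef (by rw [h]; positivity)
      · exact Filter.Eventually.of_forall fun _ => (Real.exp_pos _).le
    rw [setLIntegral_congr_fun measurableSet_Ioi h1, lintegral_inv_sqrt_pow hq]
    push_cast
    rfl
  · refine Measurable.aemeasurable ?_
    exact (Real.measurable_exp.comp (measurable_snd.neg.mul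
      (measurable_frobSq.comp measurable_fst))).ennreal_ofReal

/-- The second moment of `x G y` for a row `x` and a column `y`. -/
theorem lintegral_frobSq_row_mul_mul_col (x : Matrix (Fin 1) (Fin p) 𝕜)
    (y : Matrix (Fin q) (Fin 1) 𝕜) :
    ∫⁻ G, ENNReal.ofReal (frobSq (x * G * y)) ∂stdNormalMatrix 𝕜 p q =
      ENNReal.ofReal (realDim 𝕜 * (frobSq x * frobSq y)) := by
  by_cases h0 : frobSq x * frobSq y = 0
  · rcases mul_eq_zero.1 h0 with h | h <;> simp [eq_zero_of_frobSq_eq_zero h, frobSq]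
  have hpos : 0 < frobSq x * frobSq y :=
    lt_of_le_of_ne (mul_nonneg (frobSq_nonneg x) (frobSq_nonneg y)) (Ne.symm h0)
  -- Dividing x G y by s = ‖x‖‖y‖ makes the adjoint T ↦ s⁻¹ xᴴTyᴴ isometric, so the quotient is one
  -- standard normal scalar.
  set s := √(frobSq x * frobSq y) with hs
  have hs0 : s ≠ 0 := (Real.sqrt_pos.2 hpos).ne'
  have hs2 : s ^ 2 = frobSq x * frobSq y := Real.sq_sqrt hpos.le
  have hrank1 : ∀ T : Matrix (Fin 1) (Fin 1) 𝕜,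
      frobSq (xᴴ * T * yᴴ) = frobSq x * frobSq y * frobSq T := by
    intro T
    simp only [frobSq, Matrix.mul_apply, Finset.univ_unique, Finset.sum_singleton,
      Matrix.conjTranspose_apply, norm_mul, norm_star, mul_pow, Fin.default_eq_zero]
    rw [Finset.sum_mul_sum, Finset.sum_mul]
    refine Finset.sum_congr rfl fun i _ => ?_
    rw [Finset.sum_mul]
    refine Finset.sum_congr rfl fun j _ => ?_
    ring
  let L : Matrix (Fin p) (Fin q) 𝕜 → Matrix (Fin 1) (Fin 1) 𝕜 := fun G => s⁻¹ • (x * G * y)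
  have hm : Measurable fun G : Matrix (Fin p) (Fin q) 𝕜 => x * G * y :=
    (measurable_const.matrix_mul measurable_id).matrix_mul measurable_const
  have hL : Measurable L :=
    measurable_matrix_iff.2 fun i j => (measurable_matrix_iff.1 hm i j).const_smul s⁻¹
  have hmap := map_stdNormalMatrix hL (fun T => s⁻¹ • (xᴴ * T * yᴴ))
    (fun T M => by
      simp only [L]
      rw [rePair_smul_right, rePair_smul_left, Matrix.mul_assoc, rePair_mul_left,
        rePair_mul_right])
    (fun T => by
      rw [frobSq_smul, hrank1, ← hs2]
      field_simp)
  have heq : ∀ G, frobSq (x * G * y) = s ^ 2 * frobSq (L G) := by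
    intro G
    simp only [L]
    rw [frobSq_smul]
    field_simp
  simp_rw [heq, ENNReal.ofReal_mul (sq_nonneg s)]
  have hLm : Measurable fun G => ENNReal.ofReal (frobSq (L G)) :=
    (measurable_frobSq.comp hL).ennreal_ofReal
  rw [lintegral_const_mul _ hLm,
    ← lintegral_map (f := fun M => ENNReal.ofReal (frobSq M)) measurable_frobSq.ennreal_ofReal hL,
    hmap, lintegral_frobSq_stdNormalMatrix_one, ← ENNReal.ofReal_mul (sq_nonneg s), hs2, mul_comm]

theorem lintegral_frobSq_mul_mul (X : Matrix (Fin m) (Fin p) 𝕜) (C : Matrix (Fin q) (Fin n) 𝕜) :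
    ∫⁻ G, ENNReal.ofReal (frobSq (X * G * C)) ∂stdNormalMatrix 𝕜 p q =
      ENNReal.ofReal (realDim 𝕜 * (frobSq X * frobSq C)) := by
  let x : Fin m → Matrix (Fin 1) (Fin p) 𝕜 := fun i => Matrix.of fun _ => X i
  let y : Fin n → Matrix (Fin q) (Fin 1) 𝕜 := fun j => Matrix.of fun a _ => C a j
  have h1 : ∀ G : Matrix (Fin p) (Fin q) 𝕜, ENNReal.ofReal (frobSq (X * G * C)) =
      ∑ i, ∑ j, ENNReal.ofReal (frobSq (x i * G * y j)) := by
    intro G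
    unfold frobSq
    rw [ENNReal.ofReal_sum_of_nonneg fun _ _ => Finset.sum_nonneg fun _ _ => by positivity]
    refine Finset.sum_congr rfl fun i _ => ?_
    rw [ENNReal.ofReal_sum_of_nonneg fun _ _ => by positivity]
    refine Finset.sum_congr rfl fun j _ => ?_
    simp [x, y, Matrix.mul_apply]
  have hm : ∀ i j, Measurable fun G : Matrix (Fin p) (Fin q) 𝕜 =>
      ENNReal.ofReal (frobSq (x i * G * y j)) := fun i j =>
    (measurable_frobSq.comp ((measurable_const.matrix_mul measurable_id).matrix_mul
      measurable_const)).ennreal_ofReal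
  simp_rw [h1]
  rw [lintegral_finsetSum _ fun i _ => Finset.measurable_fun_sum _ fun j _ => hm i j]
  simp_rw [lintegral_finsetSum _ fun j _ => hm _ j, lintegral_frobSq_row_mul_mul_col]
  have h2 : frobSq X = ∑ i, frobSq (x i) := by simp [frobSq, x]
  have h3 : frobSq C = ∑ j, frobSq (y j) := by
    rw [frobSq, Finset.sum_comm]; simp [frobSq, y]
  have hnn : ∀ i j, 0 ≤ (realDim 𝕜 : ℝ) * (frobSq (x i) * frobSq (y j)) := fun i j =>
    mul_nonneg (Nat.cast_nonneg _) (mul_nonneg (frobSq_nonneg _) (frobSq_nonneg _))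
  rw [h2, h3, Finset.sum_mul_sum, Finset.mul_sum,
    ENNReal.ofReal_sum_of_nonneg fun i _ => by
      rw [Finset.mul_sum]; exact Finset.sum_nonneg fun j _ => hnn i j]
  refine Finset.sum_congr rfl fun i _ => ?_
  rw [Finset.mul_sum, ENNReal.ofReal_sum_of_nonneg fun j _ => hnn i j]

end GaussianIntegrals

end

end SketchLowRank

namespace SketchLowRank

noncomputable section

/-! ### Expected size of the pseudoinverse of a Gaussian matrix. -/

section GaussianPseudoinverse

variable {𝕜 : Type*} [RCLike 𝕜] {m n p q r d : ℕ}

theorem measurable_of_row (j : Fin p) :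
    Measurable fun M : Matrix (Fin p) (Fin q) 𝕜 => (Matrix.of fun (_ : Fin 1) => M j) :=
  measurable_matrix_iff.2 fun _ b => measurable_entry j b

theorem measurable_updateCol (j : Fin r) :
    Measurable fun z : Matrix (Fin p) (Fin r) 𝕜 × Matrix (Fin p) (Fin 1) 𝕜 =>
      z.1.updateCol j fun i => z.2 i 0 := by
  rw [measurable_matrix_iff]
  intro a b
  by_cases hb : b = j
  · subst hb
    simp only [Matrix.updateCol_self]
    exact (measurable_entry a 0).comp measurable_snd
  · simp only [Matrix.updateCol_ne hb]
    exact (measurable_entry a b).comp measurable_fst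

/-- Resampling one column of a standard normal matrix. -/
theorem map_updateCol_stdNormalMatrix (j : Fin r) :
    ((stdNormalMatrix 𝕜 p r).prod (stdNormalMatrix 𝕜 p 1)).map
      (fun z => z.1.updateCol j fun i => z.2 i 0) = stdNormalMatrix 𝕜 p r := by
  -- The adjoint splits T into T with column j erased and column j alone; their squared norms add up
  -- to that of T.
  refine map_prod_stdNormalMatrix (measurable_updateCol j) (fun T => T.updateCol j 0)
    (fun T => Matrix.of fun i _ => T i j) (fun T M N => ?_) (fun T => ?_)
  · simp only [rePair_eq_sum, ← Finset.sum_add_distrib]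
    refine Finset.sum_congr rfl fun i _ => ?_
    rw [← Finset.sum_erase_add _ _ (Finset.mem_univ j),
      ← Finset.sum_erase_add Finset.univ (fun b => RCLike.re (T.updateCol j 0 i b) *
        RCLike.re (M i b) + RCLike.im (T.updateCol j 0 i b) * RCLike.im (M i b))
        (Finset.mem_univ j)]
    simp only [Matrix.updateCol_self, Finset.univ_unique, Finset.sum_singleton, Matrix.of_apply,
      Pi.zero_apply, map_zero, zero_mul, add_zero, Fin.default_eq_zero]
    congr 1
    refine Finset.sum_congr rfl fun b hb => ?_
    rw [Matrix.updateCol_ne (Finset.ne_of_mem_erase hb),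
      Matrix.updateCol_ne (Finset.ne_of_mem_erase hb)]
  · simp only [frobSq, ← Finset.sum_add_distrib]
    refine Finset.sum_congr rfl fun i _ => ?_
    rw [← Finset.sum_erase_add _ _ (Finset.mem_univ j),
      ← Finset.sum_erase_add Finset.univ (fun b => ‖T i b‖ ^ 2) (Finset.mem_univ j)]
    simp only [Matrix.updateCol_self, Finset.univ_unique, Finset.sum_singleton, Matrix.of_apply,
      Pi.zero_apply, norm_zero, ne_eq, OfNat.ofNat_ne_zero, not_false_eq_true, zero_pow, add_zero]
    congr 1
    refine Finset.sum_congr rfl fun b hb => ?_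
    rw [Matrix.updateCol_ne (Finset.ne_of_mem_erase hb)]

theorem map_isometry_conjTranspose_mul {V : Matrix (Fin p) (Fin q) 𝕜} (hV : Vᴴ * V = 1) :
    (stdNormalMatrix 𝕜 p n).map (fun G => Vᴴ * G) = stdNormalMatrix 𝕜 q n :=
  map_stdNormalMatrix (measurable_const.matrix_mul measurable_id) (fun T => V * T)
    (fun T M => by rw [rePair_mul_left, Matrix.conjTranspose_conjTranspose])
    (frobSq_isometry_mul hV)

theorem frobSq_mul_isometry_conjTranspose {V : Matrix (Fin p) (Fin q) 𝕜} (hV : Vᴴ * V = 1)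
    (T : Matrix (Fin m) (Fin q) 𝕜) : frobSq (T * Vᴴ) = frobSq T := by
  rw [← frobSq_conjTranspose, Matrix.conjTranspose_mul, Matrix.conjTranspose_conjTranspose,
    frobSq_isometry_mul hV, frobSq_conjTranspose]

theorem map_mul_isometry {V : Matrix (Fin p) (Fin q) 𝕜} (hV : Vᴴ * V = 1) :
    (stdNormalMatrix 𝕜 n p).map (fun G => G * V) = stdNormalMatrix 𝕜 n q :=
  map_stdNormalMatrix (measurable_id.matrix_mul measurable_const) (fun T => T * Vᴴ)
    (fun T M => rePair_mul_right V T M) (frobSq_mul_isometry_conjTranspose hV)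

/-- A standard normal matrix is assembled from independent pieces acting on the range of `V` and
on its orthogonal complement. -/
theorem map_split_stdNormalMatrix {V : Matrix (Fin d) (Fin r) 𝕜} (hV : Vᴴ * V = 1) :
    ((stdNormalMatrix 𝕜 p r).prod (stdNormalMatrix 𝕜 p d)).map
      (fun z => z.1 * Vᴴ + z.2 * (1 - V * Vᴴ)) = stdNormalMatrix 𝕜 p d := by
  refine map_prod_stdNormalMatrix ((measurable_fst.matrix_mul measurable_const).matrix_add
    (measurable_snd.matrix_mul measurable_const)) (fun T => T * V) (fun T => T * (1 - V * Vᴴ))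
    (fun T M N => ?_) (fun T => ?_)
  · rw [rePair_add_right, rePair_mul_right, rePair_mul_right, Matrix.conjTranspose_sub,
      isometry_projection_conjTranspose, Matrix.conjTranspose_one,
      Matrix.conjTranspose_conjTranspose]
  · rw [← frobSq_mul_isometry_conjTranspose hV (T * V), ← frobSq_conjTranspose T,
      frobSq_eq_add_of_projection (isometry_projection_conjTranspose V)
        (isometry_projection_mul_self hV) Tᴴ, ← frobSq_conjTranspose (T * V * Vᴴ),
      ← frobSq_conjTranspose (T * (1 - V * Vᴴ))]
    simp [Matrix.conjTranspose_mul, Matrix.mul_sub, Matrix.mul_assoc]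

/-- With one column of the matrix resampled and the others fixed, the corresponding row of the
pseudoinverse has a finite second moment. -/
theorem pinv_row_updateCol (hp : p = q + r) (hq : 2 < realDim 𝕜 * q) (j : Fin (r + 1))
    (M : Matrix (Fin p) (Fin (r + 1)) 𝕜) :
    (∫⁻ g, ENNReal.ofReal (frobSq (Matrix.of fun (_ : Fin 1) =>
        pinv (M.updateCol j fun i => g i 0) j)) ∂stdNormalMatrix 𝕜 p 1 ≤
      ENNReal.ofReal (1 / ((realDim 𝕜 : ℝ) * q - 2))) ∧
    ∀ᵐ g ∂stdNormalMatrix 𝕜 p 1,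
      (pinv (M.updateCol j fun i => g i 0) * M.updateCol j fun i => g i 0) j =
        (1 : Matrix (Fin (r + 1)) (Fin (r + 1)) 𝕜) j := by
  -- V is built from the r frozen columns only, so it is independent of g and Vᴴg is standard normal
  -- in 𝕜^q.
  obtain ⟨V, hV, hVM⟩ := exists_isometry_orthogonal hp.symm (M.submatrix id j.succAbove)
  have hm : Measurable fun g : Matrix (Fin p) (Fin 1) 𝕜 => Vᴴ * g :=
    measurable_const.matrix_mul measurable_id
  have hinv : Measurable fun h : Matrix (Fin q) (Fin 1) 𝕜 => (ENNReal.ofReal (frobSq h))⁻¹ :=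
    measurable_frobSq.ennreal_ofReal.inv
  have hint : ∫⁻ g, (ENNReal.ofReal (frobSq (Vᴴ * g)))⁻¹ ∂stdNormalMatrix 𝕜 p 1 =
      ENNReal.ofReal (1 / ((realDim 𝕜 : ℝ) * q - 2)) := by
    rw [← lintegral_inv_frobSq hq, ← map_isometry_conjTranspose_mul hV, lintegral_map hinv hm]
  have hrow : ∀ g : Matrix (Fin p) (Fin 1) 𝕜, frobSq (Vᴴ * g) ≠ 0 → _ := fun g h0 =>
    pinv_row_bound (M.updateCol j fun i => g i 0) j V hV
    (by
      intro i hi a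
      obtain ⟨b, rfl⟩ := Fin.exists_succAbove_eq hi
      have := congrFun (congrFun hVM a) b
      simp only [Matrix.mul_apply, Matrix.zero_apply, Matrix.submatrix_apply, id] at this ⊢
      simpa only [Matrix.updateCol_ne hi] using this)
    (Vᴴ * g) (by intro a; simp [Matrix.mul_apply]) h0
  refine ⟨?_, ?_⟩
  · rw [← hint]
    refine lintegral_mono fun g => ?_
    -- Here the majorant is ∞, so the bound is free.
    by_cases h0 : frobSq (Vᴴ * g) = 0
    · simp [h0]
    · have hpos : 0 < frobSq (Vᴴ * g) := lt_of_le_of_ne (frobSq_nonneg _) (Ne.symm h0)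
      rw [← ENNReal.ofReal_inv_of_pos hpos]
      exact ENNReal.ofReal_le_ofReal (hrow g h0).1
  · have hfin := ae_lt_top (hinv.comp hm) (by
      simp only [Function.comp_apply]
      rw [hint]; exact ENNReal.ofReal_ne_top)
    filter_upwards [hfin] with g hg
    refine (hrow g fun h0 => ?_).2
    simp [h0] at hg

theorem lintegral_frobSq_pinv_row_le (hp : p = q + r) (hq : 2 < realDim 𝕜 * q)
    (j : Fin (r + 1)) :
    ∫⁻ G, ENNReal.ofReal (frobSq (Matrix.of fun (_ : Fin 1) => pinv G j))
        ∂stdNormalMatrix 𝕜 p (r + 1) ≤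
      ENNReal.ofReal (1 / ((realDim 𝕜 : ℝ) * q - 2)) := by
  have hF : Measurable fun G : Matrix (Fin p) (Fin (r + 1)) 𝕜 =>
      ENNReal.ofReal (frobSq (Matrix.of fun (_ : Fin 1) => pinv G j)) :=
    (measurable_frobSq.comp ((measurable_of_row j).comp measurable_pinv)).ennreal_ofReal
  rw [← map_updateCol_stdNormalMatrix j, lintegral_map hF (measurable_updateCol j)]
  refine (lintegral_prod _ (hF.comp (measurable_updateCol j)).aemeasurable).le.trans ?_
  refine (lintegral_mono fun M => (pinv_row_updateCol hp hq j M).1).trans ?_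
  simp

theorem ae_pinv_mul_self_row (hp : p = q + r) (hq : 2 < realDim 𝕜 * q) (j : Fin (r + 1)) :
    ∀ᵐ G ∂stdNormalMatrix 𝕜 p (r + 1),
      (pinv G * G) j = (1 : Matrix (Fin (r + 1)) (Fin (r + 1)) 𝕜) j := by
  have hF : Measurable fun G : Matrix (Fin p) (Fin (r + 1)) 𝕜 => (pinv G * G) j :=
    measurable_pi_iff.2 fun b =>
      measurable_matrix_iff.1 (measurable_pinv.matrix_mul measurable_id) j b
  have hset : MeasurableSet {G : Matrix (Fin p) (Fin (r + 1)) 𝕜 |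
      (pinv G * G) j = (1 : Matrix (Fin (r + 1)) (Fin (r + 1)) 𝕜) j} :=
    hF (measurableSet_singleton _)
  rw [← map_updateCol_stdNormalMatrix j, ae_map_iff (measurable_updateCol j).aemeasurable hset]
  refine (Measure.ae_prod_iff_ae_ae (measurable_updateCol j hset)).2 ?_
  exact Filter.Eventually.of_forall fun M => (pinv_row_updateCol hp hq j M).2

theorem two_lt_realDim_mul {s : ℕ} (h : r + 1 + fieldAlpha 𝕜 < p) (hs : p = s + r) :
    2 < realDim 𝕜 * s := by
  unfold realDim
  unfold fieldAlpha at *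
  split_ifs at * <;> omega

/-- A tall standard normal matrix has full column rank almost surely. -/
theorem ae_pinv_mul_self (h : r + fieldAlpha 𝕜 < p) :
    ∀ᵐ G ∂stdNormalMatrix 𝕜 p r, pinv G * G = 1 := by
  rcases r with _ | r
  · exact Filter.Eventually.of_forall fun G => Subsingleton.elim _ _
  · have hs : p = (p - r) + r := by omega
    have := ae_all_iff.2 fun j => ae_pinv_mul_self_row hs (two_lt_realDim_mul h hs) j
    filter_upwards [this] with G hG
    exact Matrix.ext fun i j => congrFun (hG i) j

/-- Here r counts the columns other than the chosen one. The factor β/(β(p - r) - 2) is 1/(p - r -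
2) over ℝ and 1/(p - r - 1) over ℂ, in both cases 1/(p - (r + 1) - α). -/
theorem realDim_mul_div_eq_fRatio (h : r + 1 + fieldAlpha 𝕜 < p) :
    (realDim 𝕜 : ℝ) * (((r + 1 : ℕ) : ℝ) * (1 / ((realDim 𝕜 : ℝ) * ((p - r : ℕ) : ℝ) - 2))) =
      fRatio 𝕜 (r + 1) p := by
  have hp : r ≤ p := by omega
  have h' : (r : ℝ) + 1 + fieldAlpha 𝕜 < p := by exact_mod_cast h
  rw [Nat.cast_sub hp]
  unfold fRatio realDim
  unfold fieldAlpha at *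
  split_ifs at * with hI
  · push_cast at *
    simp only [one_mul, mul_one_div]
    congr 1
    ring
  · push_cast at *
    have h1 : (p : ℝ) - (r + 1) - 0 ≠ 0 := by linarith
    have h2 : 2 * ((p : ℝ) - r) - 2 ≠ 0 := by linarith
    simp only [tsub_zero]
    field_simp
    ring

/-- The expected squared norm of the pseudoinverse of a tall standard normal matrix. -/
theorem lintegral_frobSq_pinv_le (h : r + fieldAlpha 𝕜 < p) :
    ENNReal.ofReal (realDim 𝕜) * ∫⁻ G, ENNReal.ofReal (frobSq (pinv G)) ∂stdNormalMatrix 𝕜 p r ≤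
      ENNReal.ofReal (fRatio 𝕜 r p) := by
  rcases r with _ | r
  · simp [frobSq]
  have hs : p = (p - r) + r := by omega
  have hF : ∀ j, Measurable fun G : Matrix (Fin p) (Fin (r + 1)) 𝕜 =>
      ENNReal.ofReal (frobSq (Matrix.of fun (_ : Fin 1) => pinv G j)) := fun j =>
    (measurable_frobSq.comp ((measurable_of_row j).comp measurable_pinv)).ennreal_ofReal
  have h1 : ∀ G : Matrix (Fin p) (Fin (r + 1)) 𝕜, ENNReal.ofReal (frobSq (pinv G)) =
      ∑ j, ENNReal.ofReal (frobSq (Matrix.of fun (_ : Fin 1) => pinv G j)) := fun G => by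
    rw [frobSq_row, ENNReal.ofReal_sum_of_nonneg fun _ _ => frobSq_nonneg _]
  simp_rw [h1]
  rw [lintegral_finsetSum _ fun j _ => hF j]
  refine (mul_le_mul_right (Finset.sum_le_sum fun j _ =>
    lintegral_frobSq_pinv_row_le hs (two_lt_realDim_mul h hs) j) _).trans (le_of_eq ?_)
  rw [Finset.sum_const, Finset.card_univ, Fintype.card_fin, ← ENNReal.ofReal_nsmul,
    ← ENNReal.ofReal_mul (Nat.cast_nonneg _), nsmul_eq_mul, realDim_mul_div_eq_fRatio h]

theorem fRatio_nonneg (h : r + fieldAlpha 𝕜 < p) : 0 ≤ fRatio 𝕜 r p := by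
  have h' : (r : ℝ) + fieldAlpha 𝕜 < p := by exact_mod_cast h
  exact div_nonneg (Nat.cast_nonneg _) (by linarith)

/-- Write G = XVᴴ + Z(1 - VVᴴ) with X and Z independent. Then GV = X and, since VᴴC = 0, GC = ZC;
integrate over Z first, then over X. -/
theorem lintegral_frobSq_pinv_mul_le (h : r + fieldAlpha 𝕜 < p) {V : Matrix (Fin d) (Fin r) 𝕜}
    (hV : Vᴴ * V = 1) {C : Matrix (Fin d) (Fin n) 𝕜} (hC : Vᴴ * C = 0) :
    ∫⁻ G, ENNReal.ofReal (frobSq (pinv (G * V) * (G * C))) ∂stdNormalMatrix 𝕜 p d ≤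
      ENNReal.ofReal (fRatio 𝕜 r p * frobSq C) := by
  have hF : Measurable fun G : Matrix (Fin p) (Fin d) 𝕜 =>
      ENNReal.ofReal (frobSq (pinv (G * V) * (G * C))) :=
    (measurable_frobSq.comp ((measurable_pinv.comp
      (measurable_id.matrix_mul measurable_const)).matrix_mul
      (measurable_id.matrix_mul measurable_const))).ennreal_ofReal
  have hL : Measurable fun z : Matrix (Fin p) (Fin r) 𝕜 × Matrix (Fin p) (Fin d) 𝕜 =>
      z.1 * Vᴴ + z.2 * (1 - V * Vᴴ) :=
    (measurable_fst.matrix_mul measurable_const).matrix_add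
      (measurable_snd.matrix_mul measurable_const)
  rw [← map_split_stdNormalMatrix hV, lintegral_map hF hL]
  refine (lintegral_prod _ (hF.comp hL).aemeasurable).le.trans ?_
  have hred : ∀ (X : Matrix (Fin p) (Fin r) 𝕜) (Z : Matrix (Fin p) (Fin d) 𝕜),
      pinv ((X * Vᴴ + Z * (1 - V * Vᴴ)) * V) * ((X * Vᴴ + Z * (1 - V * Vᴴ)) * C) =
        pinv X * Z * C := by
    intro X Z
    have h1 : (X * Vᴴ + Z * (1 - V * Vᴴ)) * V = X := by
      simp [Matrix.add_mul, Matrix.mul_assoc, Matrix.sub_mul, hV]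
    have h2 : (X * Vᴴ + Z * (1 - V * Vᴴ)) * C = Z * C := by
      simp [Matrix.add_mul, Matrix.mul_assoc, Matrix.sub_mul, hC]
    rw [h1, h2, Matrix.mul_assoc]
  simp only [Function.comp_apply, hred, lintegral_frobSq_mul_mul]
  simp_rw [ENNReal.ofReal_mul (Nat.cast_nonneg (α := ℝ) (realDim 𝕜)),
    ENNReal.ofReal_mul (frobSq_nonneg _)]
  have hX : Measurable fun X : Matrix (Fin p) (Fin r) 𝕜 => ENNReal.ofReal (frobSq (pinv X)) :=
    (measurable_frobSq.comp measurable_pinv).ennreal_ofReal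
  rw [lintegral_const_mul _ (hX.mul_const _), lintegral_mul_const _ hX, ← mul_assoc,
    ENNReal.ofReal_mul (fRatio_nonneg h)]
  exact mul_le_mul_left (lintegral_frobSq_pinv_le h) _

/-- The expected squared error of the sketched least-squares residual. -/
theorem lintegral_frobSq_sub_le (h : r + fieldAlpha 𝕜 < p) {V : Matrix (Fin d) (Fin r) 𝕜}
    (hV : Vᴴ * V = 1) {C : Matrix (Fin d) (Fin n) 𝕜} (hC : Vᴴ * C = 0) :
    ∫⁻ G, ENNReal.ofReal (frobSq (C - V * (pinv (G * V) * (G * C)))) ∂stdNormalMatrix 𝕜 p d ≤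
      ENNReal.ofReal ((1 + fRatio 𝕜 r p) * frobSq C) := by
  have hC' : Cᴴ * V = 0 := by
    have := congrArg Matrix.conjTranspose hC
    simpa [Matrix.conjTranspose_mul] using this
  have h1 : ∀ G : Matrix (Fin p) (Fin d) 𝕜,
      ENNReal.ofReal (frobSq (C - V * (pinv (G * V) * (G * C)))) =
      ENNReal.ofReal (frobSq C) + ENNReal.ofReal (frobSq (pinv (G * V) * (G * C))) := by
    intro G
    rw [frobSq_sub_of_orthogonal (by rw [← Matrix.mul_assoc, hC', Matrix.zero_mul]),
      frobSq_isometry_mul hV, ENNReal.ofReal_add (frobSq_nonneg _) (frobSq_nonneg _)]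
  simp_rw [h1]
  rw [lintegral_add_left measurable_const, add_mul, one_mul, ENNReal.ofReal_add (frobSq_nonneg _)
    (mul_nonneg (fRatio_nonneg h) (frobSq_nonneg _))]
  simpa using lintegral_frobSq_pinv_mul_le h hV hC

end GaussianPseudoinverse

end

end SketchLowRank

namespace SketchLowRank

/-! ### The two sketching stages and their composition. -/

section Assembly

variable {𝕜 : Type*} [RCLike 𝕜] {m n k ℓ r ϱ : ℕ}

theorem fRatio_mono {r ϱ k : ℕ} (hr : r ≤ ϱ) (h : ϱ + fieldAlpha 𝕜 < k) :
    fRatio 𝕜 r k ≤ fRatio 𝕜 ϱ k := by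
  have h' : (ϱ : ℝ) + fieldAlpha 𝕜 < k := by exact_mod_cast h
  have hr' : (r : ℝ) ≤ ϱ := by exact_mod_cast hr
  exact div_le_div₀ (Nat.cast_nonneg _) hr' (by linarith) (by linarith)

theorem one_add_fRatio {s t : ℕ} (h : s + fieldAlpha 𝕜 < t) :
    1 + fRatio 𝕜 s t =
      ((t : ℝ) - (fieldAlpha 𝕜 : ℝ)) / ((t : ℝ) - (s : ℝ) - (fieldAlpha 𝕜 : ℝ)) := by
  have h' : (s : ℝ) + fieldAlpha 𝕜 < t := by exact_mod_cast h
  have h0 : (t : ℝ) - s - fieldAlpha 𝕜 ≠ 0 := by linarith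
  rw [fRatio]
  field_simp
  ring

/-- If the range of the orthonormal matrix `Q` contains that of `A Gᴴ`, then projecting `A` on it
is at least as good as the oblique projection through the sketch `G`. -/
theorem frobSq_sub_projection_le {A : Matrix (Fin m) (Fin n) 𝕜} {Q : Matrix (Fin m) (Fin k) 𝕜}
    {G : Matrix (Fin k) (Fin n) 𝕜} {V : Matrix (Fin n) (Fin r) 𝕜}
    (hQ : IsQRFactor (A * Gᴴ) Q) (hX : pinv (G * V) * (G * V) = 1) :
    frobSq (A - Q * Qᴴ * A) ≤ frobSq ((Aᴴ - V * Vᴴ * Aᴴ) -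
      V * (pinv (G * V) * (G * (Aᴴ - V * Vᴴ * Aᴴ)))) := by
  obtain ⟨hQQ, R, -, hR⟩ := hQ
  set X := pinv (G * V)
  have hE : Q * Qᴴ * (A * Gᴴ) = A * Gᴴ := by
    rw [hR, Matrix.mul_assoc, ← Matrix.mul_assoc Qᴴ, hQQ, Matrix.one_mul]
  have hV : V * (X * (G * (V * (Vᴴ * Aᴴ)))) = V * (Vᴴ * Aᴴ) := by
    rw [← Matrix.mul_assoc G, ← Matrix.mul_assoc X, hX, Matrix.one_mul]
  -- The map V(GV)†G fixes the range of V, so the VVᴴAᴴ terms cancel.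
  have hW : (Aᴴ - V * Vᴴ * Aᴴ) - V * (X * (G * (Aᴴ - V * Vᴴ * Aᴴ))) =
      Aᴴ - V * (X * (G * Aᴴ)) := by
    simp only [Matrix.mul_sub, Matrix.mul_assoc, hV]
    abel
  have hW' : (Aᴴ - V * (X * (G * Aᴴ)))ᴴ = A - A * Gᴴ * (Xᴴ * Vᴴ) := by
    simp [Matrix.conjTranspose_mul, Matrix.mul_assoc]
  rw [hW, ← frobSq_conjTranspose (Aᴴ - _), hW']
  -- The correction A Gᴴ(XᴴVᴴ) lies in the range of Q, so 1 - QQᴴ kills it and maps the oblique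
  -- residual to A - QQᴴA.
  refine le_of_eq_of_le ?_ (frobSq_sub_projection_mul_le (isometry_projection_conjTranspose Q)
    (isometry_projection_mul_self hQQ) _)
  congr 1
  rw [Matrix.mul_sub, ← Matrix.mul_assoc (Q * Qᴴ), hE]
  abel

/-- The expected error of the randomized range finder. -/
theorem lintegral_frobSq_rangeFinder_le (h : ϱ + fieldAlpha 𝕜 < k) (A B : Matrix (Fin m) (Fin n) 𝕜)
    (hB : B.rank ≤ ϱ) {Q : Matrix (Fin m) (Fin k) 𝕜 → Matrix (Fin m) (Fin k) 𝕜}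
    (hQ_meas : Measurable Q) (hQ : ∀ Y, IsQRFactor Y (Q Y)) :
    ∫⁻ ω, ENNReal.ofReal (frobSq (A - Q (A * ω) * (Q (A * ω))ᴴ * A)) ∂stdNormalMatrix 𝕜 n k ≤
      ENNReal.ofReal ((1 + fRatio 𝕜 ϱ k) * frobSq (A - B)) := by
  obtain ⟨r, hr, V, hV, hBV⟩ := exists_isometry_rowSpace B
  have hrϱ : r ≤ ϱ := hr.trans_le hB
  have hrk : r + fieldAlpha 𝕜 < k := by omega
  set C := Aᴴ - V * Vᴴ * Aᴴ with hCdef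
  have hC : Vᴴ * C = 0 := by
    rw [hCdef, Matrix.mul_sub, ← Matrix.mul_assoc, ← Matrix.mul_assoc, hV, Matrix.one_mul, sub_self]
  -- Since 1 - VVᴴ annihilates Bᴴ, C is also the projection of (A - B)ᴴ.
  have hCB : frobSq C ≤ frobSq (A - B) := by
    have h1 : C = (A - B)ᴴ - V * Vᴴ * (A - B)ᴴ := by
      have h2 : V * Vᴴ * Bᴴ = Bᴴ := by
        rw [← isometry_projection_conjTranspose V, ← Matrix.conjTranspose_mul, hBV]
      rw [Matrix.conjTranspose_sub, Matrix.mul_sub, h2, hCdef]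
      abel
    rw [h1, ← frobSq_conjTranspose (A - B)]
    exact frobSq_sub_projection_mul_le (isometry_projection_conjTranspose V)
      (isometry_projection_mul_self hV) _
  have hQA : Measurable fun ω : Matrix (Fin n) (Fin k) 𝕜 => Q (A * ω) :=
    hQ_meas.comp (measurable_const.matrix_mul measurable_id)
  have hF : Measurable fun ω : Matrix (Fin n) (Fin k) 𝕜 =>
      ENNReal.ofReal (frobSq (A - Q (A * ω) * (Q (A * ω))ᴴ * A)) :=
    (measurable_frobSq.comp (measurable_const.matrix_sub ((hQA.matrix_mul
      hQA.matrix_conjTranspose).matrix_mul measurable_const))).ennreal_ofReal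
  have hfull : ∀ᵐ G ∂stdNormalMatrix 𝕜 k n, pinv (G * V) * (G * V) = 1 := by
    have := ae_pinv_mul_self hrk (𝕜 := 𝕜)
    rw [← map_mul_isometry hV] at this
    exact ae_of_ae_map (measurable_id.matrix_mul measurable_const).aemeasurable this
  have hct : Measurable (Matrix.conjTranspose : Matrix (Fin k) (Fin n) 𝕜 → _) :=
    measurable_id.matrix_conjTranspose
  rw [← map_conjTranspose_stdNormalMatrix, lintegral_map hF hct]
  calc _ ≤ ∫⁻ G, ENNReal.ofReal (frobSq (C - V * (pinv (G * V) * (G * C))))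
        ∂stdNormalMatrix 𝕜 k n := by
        refine lintegral_mono_ae ?_
        filter_upwards [hfull] with G hG
        exact ENNReal.ofReal_le_ofReal (frobSq_sub_projection_le (hQ _) hG)
    _ ≤ ENNReal.ofReal ((1 + fRatio 𝕜 r k) * frobSq C) := lintegral_frobSq_sub_le hrk hV hC
    _ ≤ _ := by
        refine ENNReal.ofReal_le_ofReal (mul_le_mul ?_ hCB (frobSq_nonneg _) ?_)
        · linarith [fRatio_mono (𝕜 := 𝕜) hrϱ h]
        · linarith [fRatio_nonneg (𝕜 := 𝕜) h]

/-- The expected error of the sketched approximation for a fixed orthonormal factor. -/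
theorem lintegral_frobSq_sub_approx_le (h : k + fieldAlpha 𝕜 < ℓ) (A : Matrix (Fin m) (Fin n) 𝕜)
    {Q : Matrix (Fin m) (Fin k) 𝕜} (hQ : Qᴴ * Q = 1) :
    ∫⁻ ψ, ENNReal.ofReal (frobSq (A - approx A ψ Q)) ∂stdNormalMatrix 𝕜 ℓ m ≤
      ENNReal.ofReal ((1 + fRatio 𝕜 k ℓ) * frobSq (A - Q * Qᴴ * A)) := by
  have hC : Qᴴ * (A - Q * Qᴴ * A) = 0 := by
    rw [Matrix.mul_sub, ← Matrix.mul_assoc, ← Matrix.mul_assoc, hQ, Matrix.one_mul, sub_self]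
  have hfull : ∀ᵐ G ∂stdNormalMatrix 𝕜 ℓ m, pinv (G * Q) * (G * Q) = 1 := by
    have := ae_pinv_mul_self h (𝕜 := 𝕜)
    rw [← map_mul_isometry hQ] at this
    exact ae_of_ae_map (measurable_id.matrix_mul measurable_const).aemeasurable this
  refine (lintegral_mono_ae ?_).trans (lintegral_frobSq_sub_le h hQ hC)
  filter_upwards [hfull] with G hG
  refine ENNReal.ofReal_le_ofReal (le_of_eq (congrArg frobSq ?_))
  -- Full column rank makes the sketched solve reproduce QQᴴA exactly, so approximating A leaves the
  -- same error as approximating A - QQᴴA.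
  have hV : Q * (pinv (G * Q) * (G * (Q * (Qᴴ * A)))) = Q * (Qᴴ * A) := by
    rw [← Matrix.mul_assoc G, ← Matrix.mul_assoc (pinv _), hG, Matrix.one_mul]
  simp only [approx, Matrix.mul_sub, Matrix.mul_assoc, hV]
  abel

theorem lintegral_frobSq_sub_approx_rangeFinder_le (hk : ϱ + fieldAlpha 𝕜 < k)
    (hℓ : k + fieldAlpha 𝕜 < ℓ) (A B : Matrix (Fin m) (Fin n) 𝕜) (hB : B.rank ≤ ϱ)
    {Q : Matrix (Fin m) (Fin k) 𝕜 → Matrix (Fin m) (Fin k) 𝕜}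
    (hQ_meas : Measurable Q) (hQ : ∀ Y, IsQRFactor Y (Q Y)) :
    ∫⁻ ω, ∫⁻ ψ, ENNReal.ofReal (frobSq (A - approx A ψ (Q (A * ω)))) ∂stdNormalMatrix 𝕜 ℓ m
        ∂stdNormalMatrix 𝕜 n k ≤
      ENNReal.ofReal ((1 + fRatio 𝕜 k ℓ) * ((1 + fRatio 𝕜 ϱ k) * frobSq (A - B))) := by
  have h0 : 0 ≤ 1 + fRatio 𝕜 k ℓ := by linarith [fRatio_nonneg (𝕜 := 𝕜) hℓ]
  refine (lintegral_mono fun ω => lintegral_frobSq_sub_approx_le hℓ A (hQ (A * ω)).1).trans ?_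
  simp_rw [ENNReal.ofReal_mul h0]
  rw [lintegral_const_mul' _ _ ENNReal.ofReal_ne_top]
  exact mul_le_mul_right (lintegral_frobSq_rangeFinder_le hk A B hB hQ_meas hQ) _

theorem measurable_frobSq_sub_approx (A : Matrix (Fin m) (Fin n) 𝕜)
    {Q : Matrix (Fin m) (Fin k) 𝕜 → Matrix (Fin m) (Fin k) 𝕜} (hQ_meas : Measurable Q) :
    Measurable fun z : Matrix (Fin n) (Fin k) 𝕜 × Matrix (Fin ℓ) (Fin m) 𝕜 =>
      frobSq (A - approx A z.2 (Q (A * z.1))) := by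
  have hQA : Measurable fun z : Matrix (Fin n) (Fin k) 𝕜 × Matrix (Fin ℓ) (Fin m) 𝕜 =>
      Q (A * z.1) := hQ_meas.comp (measurable_const.matrix_mul measurable_fst)
  exact measurable_frobSq.comp (measurable_const.matrix_sub (hQA.matrix_mul
    ((measurable_pinv.comp (measurable_snd.matrix_mul hQA)).matrix_mul
      (measurable_snd.matrix_mul measurable_const))))

/-- A bound valid for every competitor passes to the infimum because c ≥ 0; no minimizer has to be
exhibited. -/
theorem le_mul_tailEnergySq {c x : ℝ} (hc : 0 ≤ c) (A : Matrix (Fin m) (Fin n) 𝕜)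
    (h : ∀ B : Matrix (Fin m) (Fin n) 𝕜, B.rank ≤ ϱ → x ≤ c * frobSq (A - B)) :
    x ≤ c * tailEnergySq (ϱ + 1) A := by
  have : Nonempty {B : Matrix (Fin m) (Fin n) 𝕜 // B.rank < ϱ + 1} := ⟨0, by simp⟩
  rw [tailEnergySq, Real.mul_iInf_of_nonneg hc]
  exact le_ciInf fun B => h B.1 (Nat.lt_succ_iff.1 B.2)

end Assembly

end SketchLowRank

/-! ### Transfer to the given probability space. -/

theorem theorem4p1 {𝕜 : Type*} [RCLike 𝕜] {m n k ℓ : ℕ}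
    (hk : fieldAlpha 𝕜 < k) (hℓ : k + fieldAlpha 𝕜 < ℓ)
    (A : Matrix (Fin m) (Fin n) 𝕜)
    (Q : Matrix (Fin m) (Fin k) 𝕜 → Matrix (Fin m) (Fin k) 𝕜)
    (hQ_meas : Measurable Q) (hQ : ∀ Y, IsQRFactor Y (Q Y))
    {S : Type*} [MeasurableSpace S] (P : Measure S) [IsProbabilityMeasure P]
    (Ω : S → Matrix (Fin n) (Fin k) 𝕜) (Ψ : S → Matrix (Fin ℓ) (Fin m) 𝕜)
    (hΩ : IsStandardNormal Ω P) (hΨ : IsStandardNormal Ψ P) (hΩΨ : IndepFun Ω Ψ P) :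
    Integrable (fun s => frobSq (A - approx A (Ψ s) (Q (A * Ω s)))) P ∧
    ∫ s, frobSq (A - approx A (Ψ s) (Q (A * Ω s))) ∂P ≤
      (1 + fRatio 𝕜 k ℓ) *
        (eligible 𝕜 k).inf' (eligible_nonempty hk)
          (fun ϱ => (1 + fRatio 𝕜 ϱ k) * tailEnergySq (ϱ + 1) A) ∧
    (1 + fRatio 𝕜 k ℓ) *
        (eligible 𝕜 k).inf' (eligible_nonempty hk)
          (fun ϱ => (1 + fRatio 𝕜 ϱ k) * tailEnergySq (ϱ + 1) A) =
      ((ℓ : ℝ) - (fieldAlpha 𝕜 : ℝ)) / ((ℓ : ℝ) - (k : ℝ) - (fieldAlpha 𝕜 : ℝ)) *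
        (eligible 𝕜 k).inf' (eligible_nonempty hk)
          (fun ϱ => ((k : ℝ) - (fieldAlpha 𝕜 : ℝ)) /
            ((k : ℝ) - (ϱ : ℝ) - (fieldAlpha 𝕜 : ℝ)) * tailEnergySq (ϱ + 1) A) := by
  obtain ⟨hΩm, hΩlaw⟩ := hΩ.map_eq
  obtain ⟨hΨm, hΨlaw⟩ := hΨ.map_eq
  have hjoint : P.map (fun s => (Ω s, Ψ s)) =
      (stdNormalMatrix 𝕜 n k).prod (stdNormalMatrix 𝕜 ℓ m) := by
    rw [(indepFun_iff_map_prod_eq_prod_map_map hΩm hΨm).1 hΩΨ, hΩlaw, hΨlaw]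
  have hpair : AEMeasurable (fun s => (Ω s, Ψ s)) P := hΩm.prodMk hΨm
  have hF := measurable_frobSq_sub_approx (ℓ := ℓ) A hQ_meas
  have hFs : AEStronglyMeasurable (fun s => frobSq (A - approx A (Ψ s) (Q (A * Ω s)))) P :=
    (hF.comp_aemeasurable hpair).aestronglyMeasurable
  have hnn : 0 ≤ᵐ[P] fun s => frobSq (A - approx A (Ψ s) (Q (A * Ω s))) :=
    Filter.Eventually.of_forall fun _ => frobSq_nonneg _
  have hlint : ∫⁻ s, ENNReal.ofReal (frobSq (A - approx A (Ψ s) (Q (A * Ω s)))) ∂P =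
      ∫⁻ ω, ∫⁻ ψ, ENNReal.ofReal (frobSq (A - approx A ψ (Q (A * ω)))) ∂stdNormalMatrix 𝕜 ℓ m
        ∂stdNormalMatrix 𝕜 n k := by
    rw [← lintegral_prod _ hF.ennreal_ofReal.aemeasurable, ← hjoint,
      lintegral_map' hF.ennreal_ofReal.aemeasurable hpair]
  have hkℓ : 0 ≤ 1 + fRatio 𝕜 k ℓ := by linarith [fRatio_nonneg (𝕜 := 𝕜) hℓ]
  have hbound : ∀ ϱ ∈ eligible 𝕜 k, ∀ B : Matrix (Fin m) (Fin n) 𝕜, B.rank ≤ ϱ →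
      ∫⁻ s, ENNReal.ofReal (frobSq (A - approx A (Ψ s) (Q (A * Ω s)))) ∂P ≤
        ENNReal.ofReal ((1 + fRatio 𝕜 k ℓ) * ((1 + fRatio 𝕜 ϱ k) * frobSq (A - B))) :=
    fun ϱ hϱ B hB => hlint.trans_le (lintegral_frobSq_sub_approx_rangeFinder_le
      ((mem_eligible 𝕜).1 hϱ) hℓ A B hB hQ_meas hQ)
  refine ⟨⟨hFs, ?_⟩, ?_, ?_⟩
  · rw [hasFiniteIntegral_iff_ofReal hnn]
    -- The choice ϱ = 0, B = 0 is always admissible and its finite bound gives integrability.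
    exact (hbound 0 ((mem_eligible 𝕜).2 (by omega)) 0 (by simp)).trans_lt ENNReal.ofReal_lt_top
  · obtain ⟨ϱ, hϱ, hmin⟩ := Finset.exists_mem_eq_inf' (eligible_nonempty hk)
      (fun ϱ => (1 + fRatio 𝕜 ϱ k) * tailEnergySq (ϱ + 1) A)
    have hϱ0 : 0 ≤ 1 + fRatio 𝕜 ϱ k := by
      linarith [fRatio_nonneg ((mem_eligible 𝕜).1 hϱ)]
    rw [hmin, ← mul_assoc]
    refine le_mul_tailEnergySq (mul_nonneg hkℓ hϱ0) A fun B hB => ?_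
    rw [integral_eq_lintegral_of_nonneg_ae hnn hFs, mul_assoc]
    exact ENNReal.toReal_le_of_le_ofReal
      (mul_nonneg hkℓ (mul_nonneg hϱ0 (frobSq_nonneg _))) (hbound ϱ hϱ B hB)
  · rw [one_add_fRatio hℓ]
    congr 1
    refine Finset.inf'_congr _ rfl fun ϱ hϱ => ?_
    rw [one_add_fRatio ((mem_eligible 𝕜).1 hϱ)]
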